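/- Let $\Bbbk$ be a field. For $\alpha,q\in\Bbbk^*=\Bbbk\setminus\{0\}$, let $\mathscr{A}_{\alpha,q}$ be the (unital, associative) $\Bbbk$-algebra generated by $e_1,e_2,e_3$ subject to the relations $$e_1e_3=q^{-1}e_3e_1,\qquad e_2e_3=q\,e_3e_2+\alpha,\qquad e_2e_1=q^{-1}e_1e_2-q^{-1}e_3,$$ $$e_3^2+(q^2-1)\,e_3e_1e_2+\alpha q(q+1)\,e_1=0.$$ Let $n\geq 1$ be an integer, let $q\in\Bbbk^*$ not be a root of unity, and let $\alpha_i,\tilde\alpha_i\in\Bbbk^*$ for $i\in\{1,\ldots,n\}$. Then every homomorphism of $\Bbbk$-algebras $$\mathscr{A}_{\alpha_1,q}\otimes\cdots\otimes\mathscr{A}_{\alpha_n,q}\longrightarrow\mathscr{A}_{\tilde\alpha_1,q}\otimes\cdots\otimes\mathscr{A}_{\tilde\alpha_n,q}$$ (tensor products over $\Bbbk$) is invertible, i.e. is an isomorphism of $\Bbbk$-algebras. -/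

import Mathlib

open scoped TensorProduct

/-- The defining relations of `𝒜_{α,q}`, imposed on the free associative algebra in three
variables `e₁, e₂, e₃` (numbered `0, 1, 2` in `Fin 3`). -/
inductive QWeylRel {k : Type*} [Field k] (α q : k) :
    FreeAlgebra k (Fin 3) → FreeAlgebra k (Fin 3) → Prop
  /-- `e₁ e₃ = q⁻¹ e₃ e₁` -/
  | rel13 : QWeylRel α q
      (FreeAlgebra.ι k 0 * FreeAlgebra.ι k 2)
      (q⁻¹ • (FreeAlgebra.ι k 2 * FreeAlgebra.ι k 0))
  /-- `e₂ e₃ = q e₃ e₂ + α` -/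
  | rel23 : QWeylRel α q
      (FreeAlgebra.ι k 1 * FreeAlgebra.ι k 2)
      (q • (FreeAlgebra.ι k 2 * FreeAlgebra.ι k 1) + algebraMap k _ α)
  /-- `e₂ e₁ = q⁻¹ e₁ e₂ - q⁻¹ e₃` -/
  | rel21 : QWeylRel α q
      (FreeAlgebra.ι k 1 * FreeAlgebra.ι k 0)
      (q⁻¹ • (FreeAlgebra.ι k 0 * FreeAlgebra.ι k 1) - q⁻¹ • FreeAlgebra.ι k 2)
  /-- `e₃² + (q² - 1) e₃ e₁ e₂ + α q (q + 1) e₁ = 0` -/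
  | relCentral : QWeylRel α q
      (FreeAlgebra.ι k 2 ^ 2
        + (q ^ 2 - 1) • (FreeAlgebra.ι k 2 * FreeAlgebra.ι k 0 * FreeAlgebra.ι k 1)
        + (α * q * (q + 1)) • FreeAlgebra.ι k 0)
      0

/-- The algebra `𝒜_{α,q}`: the quotient of the free associative `k`-algebra on `e₁, e₂, e₃`
by the two-sided ideal generated by the relations `QWeylRel α q`. -/
def QWeyl {k : Type*} [Field k] (α q : k) : Type _ := RingQuot (QWeylRel α q)

noncomputable instance QWeyl.instRing {k : Type*} [Field k] (α q : k) : Ring (QWeyl α q) :=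
  inferInstanceAs (Ring (RingQuot (QWeylRel α q)))

noncomputable instance QWeyl.instAlgebra {k : Type*} [Field k] (α q : k) :
    Algebra k (QWeyl α q) :=
  inferInstanceAs (Algebra k (RingQuot (QWeylRel α q)))

/-! Write `x = e₃`, `y = e₂` and `h = (q - 1) x y + α`. Then `h x = q x h`, `y h = q h y`, and the
last defining relation makes `h` invertible and gives `e₁ = -q/(q+1) h⁻¹ x²`. So the algebra is a
quantum Weyl algebra localised at its normal element, and it embeds in a quantum torus by `h ↦ α h`,
`x ↦ x`, `y ↦ α/(q-1) (x⁻¹ h - x⁻¹)`. The tensor product embeds likewise in a torus of rank `2n`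
(`tensorToTorus`).

Units of the torus are scaled monomials. The torus acts on functions on `ℤⁿ`, and the image of the
tensor product preserves each half space `0 ≤ m i`, since `yᵢ` vanishes on the wall `m i = 0`. Hence
units of the tensor product are scaled monomials in the `hᵢ` alone
(`exists_tensorToTorus_of_isUnit`), and a homomorphism `φ` sends `hₗ` to `cₗ h^(M l)` for an integer
matrix `M`.

Comparing `q`-commutation weights shows that `M` is invertible over `ℤ` and that `φ` is injective
(`injective_of_map_normalElt`). With `D = M⁻¹`, the image of `xₗ` or `yₗ` has a negative weight in
direction `i` as soon as `D i l ≠ 0`. It therefore kills the wall `m i = 0`, and the formulas for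
`xₗ yₗ` and `yₗ xₗ` then prescribe the eigenvalues of the image of `hₗ` on that wall. As `q` is not
a root of unity, `M` is a signed permutation matrix (`eq_single_of_ne_zero`).

Finally the images of `xₗ` and `yₗ`, in the order given by the sign, have weights `±eᵢ` and product
a unit times `xᵢ yᵢ`. Such a factorisation is unique up to units (`exists_eq_torusTensor_mul`), so
`xᵢ` and `yᵢ` lie in the range and `φ` is surjective. -/

/-! ### The quantum torus: ring structure, zero divisors, units -/

/-- The quantum torus on `2n` generators: it has a basis of monomials indexed by pairs
`(a, d)` of exponent vectors, and
`x ^ d h ^ a * x ^ d' h ^ a' = q ^ (a ⬝ d') x ^ (d + d') h ^ (a + a')`. -/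
def QuantumTorus {k : Type*} [Field k] (_q : kˣ) (ι : Type*) : Type _ :=
  ((ι → ℤ) × (ι → ℤ)) →₀ k

namespace QuantumTorus

variable {k : Type*} [Field k] {q : kˣ} {ι : Type*}

noncomputable instance : AddCommGroup (QuantumTorus q ι) :=
  inferInstanceAs (AddCommGroup (((ι → ℤ) × (ι → ℤ)) →₀ k))

noncomputable instance : Module k (QuantumTorus q ι) :=
  inferInstanceAs (Module k (((ι → ℤ) × (ι → ℤ)) →₀ k))

/-- The coefficients of an element of the quantum torus. -/
def coeff (p : QuantumTorus q ι) : ((ι → ℤ) × (ι → ℤ)) →₀ k := p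

/-- The coefficients, as a linear equivalence. -/
noncomputable def coeffEquiv : QuantumTorus q ι ≃ₗ[k] (((ι → ℤ) × (ι → ℤ)) →₀ k) := LinearEquiv.refl _ _

/-- The monomial `x ^ d h ^ a` for `g = (a, d)`. -/
noncomputable def mono (q : kˣ) (g : (ι → ℤ) × (ι → ℤ)) : QuantumTorus q ι := Finsupp.single g 1

@[simp] lemma coeff_sub (p p' : QuantumTorus q ι) : (p - p').coeff = p.coeff - p'.coeff := rfl
@[simp] lemma coeff_zero : (0 : QuantumTorus q ι).coeff = 0 := rfl
@[simp] lemma coeff_smul (a : k) (p : QuantumTorus q ι) : (a • p).coeff = a • p.coeff := rfl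
lemma coeff_sum {κ : Type*} (s : Finset κ) (f : κ → QuantumTorus q ι) :
    (∑ i ∈ s, f i).coeff = ∑ i ∈ s, (f i).coeff :=
  map_sum (coeffEquiv (q := q) (ι := ι)) f s
@[simp] lemma coeff_mono (g : (ι → ℤ) × (ι → ℤ)) :
    (mono q g).coeff = Finsupp.single g 1 := rfl

lemma coeff_injective : Function.Injective (coeff : QuantumTorus q ι → _) := fun _ _ h => h

lemma coeff_eq_zero {p : QuantumTorus q ι} : p.coeff = 0 ↔ p = 0 := Iff.rfl

lemma eq_sum_mono (p : QuantumTorus q ι) : p = ∑ g ∈ p.coeff.support, p.coeff g • mono q g := by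
  have h := (Finsupp.sum_single p.coeff).symm
  simp only [← Finsupp.smul_single_one _ (p.coeff _), Finsupp.sum] at h
  exact h

lemma induction_on {motive : QuantumTorus q ι → Prop} (p : QuantumTorus q ι) (zero : motive 0)
    (add : ∀ p p', motive p → motive p' → motive (p + p'))
    (smul_mono : ∀ (a : k) g, motive (a • mono q g)) : motive p := by
  refine Finsupp.induction_linear p zero add fun g a => ?_
  have h := smul_mono a g
  have h' : a • mono q g = (Finsupp.single g a : ((ι → ℤ) × (ι → ℤ)) →₀ k) :=
    Finsupp.smul_single_one g a
  exact h' ▸ h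

/-- The linear map with prescribed values on monomials. -/
noncomputable def linearLift {M : Type*} [AddCommMonoid M] [Module k M]
    (f : (ι → ℤ) × (ι → ℤ) → M) : QuantumTorus q ι →ₗ[k] M := Finsupp.linearCombination k f

@[simp] lemma linearLift_mono {M : Type*} [AddCommMonoid M] [Module k M]
    (f : (ι → ℤ) × (ι → ℤ) → M) (g : (ι → ℤ) × (ι → ℤ)) :
    linearLift f (mono q g) = f g := by
  rw [linearLift, mono]
  exact (Finsupp.linearCombination_single k _ _).trans (one_smul _ _)

noncomputable instance : One (QuantumTorus q ι) := ⟨mono q 0⟩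

lemma one_def : (1 : QuantumTorus q ι) = mono q 0 := rfl

variable [Fintype ι]

/-- Multiplication in the quantum torus as a bilinear map. -/
noncomputable def mulLinear : QuantumTorus q ι →ₗ[k] QuantumTorus q ι →ₗ[k] QuantumTorus q ι :=
  linearLift fun g => linearLift fun g' => ((q ^ (g.1 ⬝ᵥ g'.2) : kˣ) : k) • mono q (g + g')

noncomputable instance : Mul (QuantumTorus q ι) := ⟨fun p p' => mulLinear p p'⟩

lemma mul_def (p p' : QuantumTorus q ι) : p * p' = mulLinear p p' := rfl

lemma mono_mul_mono (g g' : (ι → ℤ) × (ι → ℤ)) :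
    mono q g * mono q g' = ((q ^ (g.1 ⬝ᵥ g'.2) : kˣ) : k) • mono q (g + g') := by
  simp [mul_def, mulLinear]

noncomputable instance : Ring (QuantumTorus q ι) :=
  { (inferInstance : AddCommGroup (QuantumTorus q ι)) with
    left_distrib := fun p p' p'' => by simp [mul_def]
    right_distrib := fun p p' p'' => by simp [mul_def]
    zero_mul := fun p => by simp [mul_def]
    mul_zero := fun p => by simp [mul_def]
    one_mul := fun p => by
      simp only [mul_def]
      induction p using induction_on with
      | zero => simp
      | add p p' h h' => simp only [map_add, h, h']
      | smul_mono a g => simp [one_def, mulLinear]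
    mul_one := fun p => by
      simp only [mul_def]
      induction p using induction_on with
      | zero => simp
      | add p p' h h' => simp only [map_add, LinearMap.add_apply, h, h']
      | smul_mono a g => simp [one_def, mulLinear]
    mul_assoc := fun p p' p'' => by
      simp only [mul_def]
      induction p using induction_on with
      | zero => simp
      | add p r h h' => simp only [map_add, LinearMap.add_apply, h, h']
      | smul_mono a g =>
      induction p' using induction_on with
      | zero => simp
      | add p r h h' => simp only [map_add, LinearMap.add_apply, h, h']
      | smul_mono a' g' =>
      induction p'' using induction_on with
      | zero => simp
      | add p r h h' => simp only [map_add, h, h']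
      | smul_mono a'' g'' =>
      simp only [mulLinear, map_smul, LinearMap.smul_apply, linearLift_mono, smul_smul,
        add_assoc, Prod.fst_add, Prod.snd_add, add_dotProduct, dotProduct_add, zpow_add,
        Units.val_mul]
      congr 1
      ring }

noncomputable instance : Algebra k (QuantumTorus q ι) :=
  Algebra.ofModule (fun a p p' => by simp [mul_def]) (fun a p p' => by simp [mul_def])


lemma isUnit_smul_mono {c : k} (hc : c ≠ 0) (g : (ι → ℤ) × (ι → ℤ)) :
    IsUnit (c • mono q g) := by
  have key : ∀ g : (ι → ℤ) × (ι → ℤ), ∃ c : k, c ≠ 0 ∧ mono q g * mono q (-g) = c • 1 := by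
    intro g
    exact ⟨_, Units.ne_zero _, by rw [mono_mul_mono, add_neg_cancel, one_def]⟩
  have h1 : IsUnit (mono q g) := by
    obtain ⟨c₁, h₁, e₁⟩ := key g
    obtain ⟨c₂, h₂, e₂⟩ := key (-g)
    rw [neg_neg] at e₂
    rw [isUnit_iff_exists_and_exists]
    exact ⟨⟨c₁⁻¹ • mono q (-g), by rw [mul_smul_comm, e₁, smul_smul, inv_mul_cancel₀ h₁, one_smul]⟩,
      ⟨c₂⁻¹ • mono q (-g), by rw [smul_mul_assoc, e₂, smul_smul, inv_mul_cancel₀ h₂, one_smul]⟩⟩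
  exact (h1.smul (Units.mk0 c hc) : )

lemma coeff_mul (p p' : QuantumTorus q ι) (g : (ι → ℤ) × (ι → ℤ)) [DecidableEq ι] :
    (p * p').coeff g = ∑ x ∈ p.coeff.support ×ˢ p'.coeff.support,
      if x.1 + x.2 = g then
        p.coeff x.1 * p'.coeff x.2 * ((q ^ (x.1.1 ⬝ᵥ x.2.2) : kˣ) : k) else 0 := by
  conv_lhs => rw [eq_sum_mono p, eq_sum_mono p', Finset.sum_mul_sum, ← Finset.sum_product']
  rw [coeff_sum, Finsupp.finsetSum_apply]
  refine Finset.sum_congr rfl fun x _ => ?_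
  rw [smul_mul_smul_comm, mono_mul_mono, smul_smul]
  rw [coeff_smul, coeff_mono, Finsupp.smul_apply, Finsupp.single_apply, smul_eq_mul, mul_ite,
    mul_one, mul_zero]

lemma coeff_mul_of_uniqueAdd {p p' : QuantumTorus q ι} {g g' : (ι → ℤ) × (ι → ℤ)}
    (h : UniqueAdd p.coeff.support p'.coeff.support g g') :
    (p * p').coeff (g + g') = p.coeff g * p'.coeff g' * ((q ^ (g.1 ⬝ᵥ g'.2) : kˣ) : k) := by
  classical
  rw [coeff_mul]
  refine (Finset.sum_eq_single (g, g') ?_ ?_).trans (if_pos rfl) <;> simp_rw [Finset.mem_product]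
  · refine fun ab hab hne ↦ if_neg (fun he ↦ hne <| Prod.ext ?_ ?_)
    exacts [(h hab.1 hab.2 he).1, (h hab.1 hab.2 he).2]
  · refine fun hnotMem ↦ ite_eq_right_iff.mpr (fun _ ↦ ?_)
    rcases not_and_or.mp hnotMem with af | bg
    · rw [Finsupp.notMem_support_iff.mp af, zero_mul, zero_mul]
    · rw [Finsupp.notMem_support_iff.mp bg, mul_zero, zero_mul]

/-- The exponent lattice has unique sums: for two nonzero factors some exponent of the product
arises from exactly one pair, so its coefficient is a product of nonzero scalars. -/
instance : NoZeroDivisors (QuantumTorus q ι) where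
  eq_zero_or_eq_zero_of_mul_eq_zero {a b} hab := by
    contrapose! hab
    simp only [ne_eq, ← coeff_eq_zero, ← Finsupp.support_nonempty_iff] at hab
    obtain ⟨da, a0, db, b0, h⟩ := UniqueSums.uniqueAdd_of_nonempty hab.1 hab.2
    rw [Finsupp.mem_support_iff] at a0 b0
    intro h0
    have := coeff_mul_of_uniqueAdd h
    rw [h0] at this
    exact mul_ne_zero (mul_ne_zero a0 b0) (Units.ne_zero _) this.symm

instance : Nontrivial (QuantumTorus q ι) :=
  ⟨⟨1, 0, fun h => by
    have := congrArg (fun p => p.coeff 0) h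
    simp [one_def] at this⟩⟩

/-- A factor of a monomial is a monomial. -/
lemma eq_smul_mono_of_mul_eq {p p' : QuantumTorus q ι} {c : k} (hc : c ≠ 0)
    {g : (ι → ℤ) × (ι → ℤ)} (h : p * p' = c • mono q g) :
    (∃ a : k, a ≠ 0 ∧ ∃ b, p = a • mono q b) ∧ ∃ a : k, a ≠ 0 ∧ ∃ b, p' = a • mono q b := by
  have hne : p * p' ≠ 0 := h ▸ (isUnit_smul_mono hc g).ne_zero
  have key : ∀ r : QuantumTorus q ι, r.coeff.support.card = 1 →
      ∃ a : k, a ≠ 0 ∧ ∃ b, r = a • mono q b := by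
    intro r hr
    obtain ⟨b, a, ha, hb⟩ := Finsupp.card_support_eq_one'.1 hr
    refine ⟨a, ha, b, coeff_injective ?_⟩
    rw [hb]; simp
  -- With more than one pair of exponents, two distinct pairs would each have a unique sum. Both
  -- sums would carry nonzero coefficients, hence both equal `g`, contradicting uniqueness.
  have hcard : p.coeff.support.card * p'.coeff.support.card ≤ 1 := by
    by_contra! hlt
    obtain ⟨x, hx, y, hy, hxy, ux, uy⟩ := TwoUniqueSums.uniqueAdd_of_one_lt_card hlt
    rw [Finset.mem_product, Finsupp.mem_support_iff, Finsupp.mem_support_iff] at hx hy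
    have ex : x.1 + x.2 = g := by
      by_contra hx'
      have := coeff_mul_of_uniqueAdd ux
      rw [h] at this
      simp [Ne.symm hx', hx.1, hx.2] at this
      exact absurd this (zpow_ne_zero _ q.ne_zero)
    have ey : y.1 + y.2 = g := by
      by_contra hx'
      have := coeff_mul_of_uniqueAdd uy
      rw [h] at this
      simp [Ne.symm hx', hy.1, hy.2] at this
      exact absurd this (zpow_ne_zero _ q.ne_zero)
    have := ux (Finsupp.mem_support_iff.2 hy.1) (Finsupp.mem_support_iff.2 hy.2) (ey.trans ex.symm)
    exact hxy (Prod.ext this.1.symm this.2.symm)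
  have h1 : 0 < p.coeff.support.card := Finset.card_pos.2
    (Finsupp.support_nonempty_iff.2 (coeff_eq_zero.not.2 (left_ne_zero_of_mul hne)))
  have h2 : 0 < p'.coeff.support.card := Finset.card_pos.2
    (Finsupp.support_nonempty_iff.2 (coeff_eq_zero.not.2 (right_ne_zero_of_mul hne)))
  exact ⟨key p (by nlinarith), key p' (by nlinarith)⟩

/-- Every unit of the quantum torus is a scalar multiple of a monomial. -/
lemma eq_smul_mono_of_isUnit {p : QuantumTorus q ι} (hp : IsUnit p) :
    ∃ a : k, a ≠ 0 ∧ ∃ b, p = a • mono q b := by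
  obtain ⟨u, rfl⟩ := hp
  exact (eq_smul_mono_of_mul_eq (one_ne_zero (α := k)) (g := 0)
    (by rw [u.mul_inv, one_smul, one_def])).1

/-- An element that `q`-commutes with a monomial in the `h` variables is homogeneous for the
corresponding grading. -/
lemma dotProduct_eq_of_mono_mul (hq : ∀ m : ℤ, q ^ m = 1 → m = 0) {p : QuantumTorus q ι}
    {M : ι → ℤ} {s : ℤ} (h : mono q (M, 0) * p = ((q ^ s : kˣ) : k) • (p * mono q (M, 0)))
    {g : (ι → ℤ) × (ι → ℤ)} (hg : g ∈ p.coeff.support) : M ⬝ᵥ g.2 = s := by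
  classical
  have h1 : (mono q (M, 0) * p).coeff ((M, 0) + g) =
      p.coeff g * ((q ^ (M ⬝ᵥ g.2) : kˣ) : k) := by
    rw [coeff_mul_of_uniqueAdd]
    · simp
    · intro a b ha _ hab
      have : a = (M, 0) := by
        by_contra hne
        simp at ha
        exact hne ha
      subst this
      exact ⟨rfl, add_left_cancel hab⟩
  have h2 : (p * mono q (M, 0)).coeff (g + (M, 0)) = p.coeff g := by
    rw [coeff_mul_of_uniqueAdd]
    · simp
    · intro a b _ hb hab
      have : b = (M, 0) := by
        by_contra hne
        simp at hb
        exact hne hb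
      subst this
      exact ⟨add_right_cancel hab, rfl⟩
  rw [h, coeff_smul, Finsupp.smul_apply, add_comm, h2, smul_eq_mul, mul_comm] at h1
  have h3 := mul_left_cancel₀ (Finsupp.mem_support_iff.1 hg) h1
  have h4 : q ^ (M ⬝ᵥ g.2 - s) = 1 := by
    rw [zpow_sub, ← Units.ext h3, mul_inv_cancel]
  exact sub_eq_zero.1 (hq _ h4)

/-! ### The representation on the lattice -/

/-- The action of a monomial on finitely supported functions on the lattice. -/
noncomputable def latticeOp (q : kˣ) (g : (ι → ℤ) × (ι → ℤ)) : Module.End k ((ι → ℤ) →₀ k) :=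
  Finsupp.linearCombination k fun m =>
    Finsupp.single (m + g.2) ((q ^ (g.1 ⬝ᵥ m) : kˣ) : k)

lemma latticeOp_single (g : (ι → ℤ) × (ι → ℤ)) (m : ι → ℤ) (a : k) :
    latticeOp q g (Finsupp.single m a) =
      Finsupp.single (m + g.2) (a * ((q ^ (g.1 ⬝ᵥ m) : kˣ) : k)) := by
  rw [latticeOp, Finsupp.linearCombination_single, Finsupp.smul_single, smul_eq_mul]

/-- The representation of the quantum torus on functions on the lattice: `x` acts by shifts
and `h ^ a` acts diagonally. -/
noncomputable def latticeRep : QuantumTorus q ι →ₐ[k] Module.End k ((ι → ℤ) →₀ k) :=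
  AlgHom.ofLinearMap (linearLift (latticeOp q))
    (by
      rw [one_def, linearLift_mono]
      exact Finsupp.lhom_ext fun m a => by simp [latticeOp_single])
    (by
      intro p p'
      induction p using induction_on with
      | zero => simp
      | add p r h h' => simp only [add_mul, map_add, h, h']
      | smul_mono a g =>
      induction p' using induction_on with
      | zero => simp
      | add p r h h' => simp only [mul_add, map_add, h, h']
      | smul_mono a' g' =>
      rw [smul_mul_smul_comm, mono_mul_mono]
      simp only [map_smul, linearLift_mono, smul_mul_smul_comm]
      congr 1
      refine Finsupp.lhom_ext fun m b => ?_
      rw [LinearMap.smul_apply, Module.End.mul_apply, latticeOp_single, latticeOp_single,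
        latticeOp_single, Finsupp.smul_single, smul_eq_mul]
      simp only [Prod.fst_add, Prod.snd_add, add_dotProduct, dotProduct_add, zpow_add,
        Units.val_mul]
      congr 1
      · abel
      · ring)

lemma latticeRep_mono (g : (ι → ℤ) × (ι → ℤ)) (m : ι → ℤ) (a : k) :
    latticeRep (mono q g) (Finsupp.single m a) =
      Finsupp.single (m + g.2) (a * ((q ^ (g.1 ⬝ᵥ m) : kˣ) : k)) := by
  simp [latticeRep, latticeOp_single]

lemma exists_mem_support_of_latticeRep {p : QuantumTorus q ι} {m w : ι → ℤ}
    (h : latticeRep p (Finsupp.single m 1) w ≠ 0) : ∃ g ∈ p.coeff.support, w = m + g.2 := by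
  rw [eq_sum_mono p, map_sum, LinearMap.sum_apply, Finsupp.finsetSum_apply] at h
  obtain ⟨g, hg, hne⟩ := Finset.exists_ne_zero_of_sum_ne_zero h
  refine ⟨g, hg, ?_⟩
  by_contra hw
  simp [latticeRep_mono, Ne.symm hw] at hne

end QuantumTorus

/-! ### Generators, the invertible normal element, and the universal property -/

namespace QWeyl

variable {k : Type*} [Field k] {α q : k}

/-- The quotient map from the free algebra. -/
noncomputable def mk (α q : k) : FreeAlgebra k (Fin 3) →ₐ[k] QWeyl α q :=
  RingQuot.mkAlgHom k (QWeylRel α q)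

lemma mk_surjective : Function.Surjective (mk α q) := RingQuot.mkAlgHom_surjective k _

lemma mk_eq_of_rel {a b : FreeAlgebra k (Fin 3)} (h : QWeylRel α q a b) :
    mk α q a = mk α q b := RingQuot.mkAlgHom_rel k h

/-- The generators `e₁, e₂, e₃`, numbered `0, 1, 2`. -/
noncomputable def gen (α q : k) (i : Fin 3) : QWeyl α q := mk α q (FreeAlgebra.ι k i)

lemma gen_rel13 : gen α q 0 * gen α q 2 = q⁻¹ • (gen α q 2 * gen α q 0) := by
  simpa [gen] using mk_eq_of_rel (QWeylRel.rel13 (α := α) (q := q))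

lemma gen_rel23 : gen α q 1 * gen α q 2 = q • (gen α q 2 * gen α q 1) + α • 1 := by
  simpa [gen, Algebra.algebraMap_eq_smul_one] using mk_eq_of_rel (QWeylRel.rel23 (α := α) (q := q))

lemma gen_rel21 : gen α q 1 * gen α q 0 =
    q⁻¹ • (gen α q 0 * gen α q 1) - q⁻¹ • gen α q 2 := by
  simpa [gen] using mk_eq_of_rel (QWeylRel.rel21 (α := α) (q := q))

lemma gen_relCentral : gen α q 2 * gen α q 2 =
    (1 - q ^ 2) • (gen α q 2 * (gen α q 0 * gen α q 1)) - (α * q * (q + 1)) • gen α q 0 := by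
  have h : gen α q 2 ^ 2 + (q ^ 2 - 1) • (gen α q 2 * gen α q 0 * gen α q 1)
      + (α * q * (q + 1)) • gen α q 0 = 0 := by
    simpa only [map_add, map_smul, map_mul, map_pow, map_zero, gen] using
      mk_eq_of_rel (QWeylRel.relCentral (α := α) (q := q))
  rw [pow_two, mul_assoc] at h
  rw [← sub_eq_zero, ← h]
  module

/-- To prove that a subspace is everything, check that it contains `1` and is stable under left
multiplication by the generators. -/
lemma eq_top_of_gen_mul_mem {S : Submodule k (QWeyl α q)} (h1 : 1 ∈ S)
    (h : ∀ i, ∀ z ∈ S, gen α q i * z ∈ S) : S = ⊤ := by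
  have key : ∀ f : FreeAlgebra k (Fin 3), ∀ z ∈ S, mk α q f * z ∈ S := by
    intro f
    induction f using FreeAlgebra.induction with
    | grade0 r =>
      intro z hz
      rw [AlgHom.commutes, ← Algebra.smul_def]
      exact S.smul_mem _ hz
    | grade1 i => exact h i
    | mul a b ha hb =>
      intro z hz
      rw [map_mul, mul_assoc]
      exact ha _ (hb z hz)
    | add a b ha hb =>
      intro z hz
      rw [map_add, add_mul]
      exact S.add_mem (ha z hz) (hb z hz)
  rw [eq_top_iff]
  rintro z -
  obtain ⟨f, rfl⟩ := mk_surjective z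
  simpa using key f 1 h1

lemma range_le_of_gen_mem {B : Type*} [Ring B] [Algebra k B] (f : QWeyl α q →ₐ[k] B)
    {C : Subalgebra k B} (h : ∀ i, f (gen α q i) ∈ C) : f.range ≤ C := by
  have : Subalgebra.toSubmodule (C.comap f) = ⊤ :=
    eq_top_of_gen_mul_mem (C.comap f).one_mem fun i z hz => (C.comap f).mul_mem (h i) hz
  rintro _ ⟨z, rfl⟩
  exact (this.ge trivial : z ∈ Subalgebra.toSubmodule (C.comap f))

/-- The normal element `h` of `𝒜_{α,q}`. -/
noncomputable def normalElt (α q : k) : QWeyl α q :=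
  (q - 1) • (gen α q 2 * gen α q 1) + α • 1

/-- The inverse of the normal element. -/
noncomputable def normalInv (α q : k) : QWeyl α q :=
  (q * α ^ 2)⁻¹ • ((α * (1 + q)) • 1 - normalElt α q
    - ((q + 1) * (q - 1) ^ 2) • (gen α q 0 * (gen α q 1 * gen α q 1)))

lemma gen_rel13_assoc (z : QWeyl α q) :
    gen α q 0 * (gen α q 2 * z) = q⁻¹ • (gen α q 2 * (gen α q 0 * z)) := by
  rw [← mul_assoc, gen_rel13, smul_mul_assoc, mul_assoc]

lemma gen_rel23_assoc (z : QWeyl α q) :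
    gen α q 1 * (gen α q 2 * z) = q • (gen α q 2 * (gen α q 1 * z)) + α • z := by
  rw [← mul_assoc, gen_rel23, add_mul, smul_mul_assoc, smul_mul_assoc, one_mul, mul_assoc]

lemma gen_rel21_assoc (z : QWeyl α q) : gen α q 1 * (gen α q 0 * z) =
    q⁻¹ • (gen α q 0 * (gen α q 1 * z)) - q⁻¹ • (gen α q 2 * z) := by
  rw [← mul_assoc, gen_rel21, sub_mul, smul_mul_assoc, smul_mul_assoc, mul_assoc]

lemma gen_relCentral_assoc (z : QWeyl α q) : gen α q 2 * (gen α q 2 * z) =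
    (1 - q ^ 2) • (gen α q 2 * (gen α q 0 * (gen α q 1 * z)))
      - (α * q * (q + 1)) • (gen α q 0 * z) := by
  rw [← mul_assoc, gen_relCentral, sub_mul, smul_mul_assoc, smul_mul_assoc, mul_assoc, mul_assoc]

/-- The formula comes from `(q+1) h e₁ = -q x²` together with `q (q-1)² x² y² = (h - qα)(h - α)`.
Substituting the second into `h e₁ y²` expresses the constant term `q α²` as a multiple of `h`. -/
lemma normalElt_mul_normalInv (hα : α ≠ 0) (hq : q ≠ 0) :
    normalElt α q * normalInv α q = 1 := by
  simp only [normalElt, normalInv, mul_add, add_mul, mul_sub, sub_mul, smul_add, smul_sub, smul_smul,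
    smul_mul_assoc, mul_smul_comm, mul_one, one_mul, mul_assoc, gen_rel23_assoc,
    gen_rel21_assoc, gen_relCentral_assoc]
  match_scalars <;> field_simp <;> ring

lemma normalInv_mul_normalElt (hα : α ≠ 0) (hq : q ≠ 0) :
    normalInv α q * normalElt α q = 1 := by
  simp only [normalElt, normalInv, mul_add, add_mul, mul_sub, sub_mul, smul_add, smul_sub, smul_smul,
    smul_mul_assoc, mul_smul_comm, mul_one, one_mul, mul_assoc, gen_rel13_assoc,
    gen_rel23_assoc, gen_relCentral_assoc]
  match_scalars <;> field_simp <;> ring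

lemma normalElt_mul_gen_two :
    normalElt α q * gen α q 2 = q • (gen α q 2 * normalElt α q) := by
  simp only [normalElt, mul_add, add_mul, smul_add, smul_smul,
    smul_mul_assoc, mul_smul_comm, mul_one, one_mul, mul_assoc, gen_rel23]
  module

lemma gen_one_mul_normalElt :
    gen α q 1 * normalElt α q = q • (normalElt α q * gen α q 1) := by
  simp only [normalElt, mul_add, add_mul, smul_add, smul_smul,
    smul_mul_assoc, mul_smul_comm, mul_one, one_mul, mul_assoc, gen_rel23_assoc]
  module

lemma gen_two_mul_gen_one (hq1 : q ≠ 1) :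
    gen α q 2 * gen α q 1 = (q - 1)⁻¹ • (normalElt α q - α • 1) := by
  rw [normalElt, add_sub_cancel_right, smul_smul, inv_mul_cancel₀ (sub_ne_zero.2 hq1), one_smul]

lemma gen_one_mul_gen_two (hq1 : q ≠ 1) :
    gen α q 1 * gen α q 2 = (q - 1)⁻¹ • (q • normalElt α q - α • 1) := by
  have := sub_ne_zero.2 hq1
  rw [gen_rel23, gen_two_mul_gen_one hq1]
  match_scalars <;> field_simp
  ring

lemma normalElt_mul_gen_zero (hq : q ≠ 0) (hq1 : q + 1 ≠ 0) :
    normalElt α q * gen α q 0 = (-q / (q + 1)) • (gen α q 2 * gen α q 2) := by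
  simp only [normalElt, mul_add, add_mul, mul_sub, sub_mul, smul_sub, smul_smul,
    smul_mul_assoc, mul_smul_comm, mul_one, one_mul, mul_assoc, gen_rel21, gen_relCentral]
  match_scalars <;> field_simp <;> ring

lemma gen_zero_eq (hα : α ≠ 0) (hq : q ≠ 0) (hq1 : q + 1 ≠ 0) :
    gen α q 0 = (-q / (q + 1)) • (normalInv α q * (gen α q 2 * gen α q 2)) := by
  rw [← mul_smul_comm, ← normalElt_mul_gen_zero hq hq1, ← mul_assoc,
    normalInv_mul_normalElt hα hq, one_mul]

/-- The normal element as a unit. -/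
noncomputable def normalUnit (hα : α ≠ 0) (hq : q ≠ 0) : (QWeyl α q)ˣ where
  val := normalElt α q
  inv := normalInv α q
  val_inv := normalElt_mul_normalInv hα hq
  inv_val := normalInv_mul_normalElt hα hq

/-- The weight vectors `x ^ d` for `d ≥ 0` and `y ^ (-d)` for `d < 0`. -/
noncomputable def weightElt (α q : k) : ℤ → QWeyl α q
  | .ofNat m => gen α q 2 ^ m
  | .negSucc m => gen α q 1 ^ (m + 1)

/-- The homomorphism out of `𝒜_{α,q}` given by a quantum Weyl pair whose normal element is
invertible. -/
noncomputable def lift {B : Type*} [Ring B] [Algebra k B] (hq : q ≠ 0) (hq1 : q ≠ 1)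
    (hq2 : q + 1 ≠ 0) (h hi x y : B) (hhi : h * hi = 1) (hih : hi * h = 1)
    (hx : h * x = q • (x * h)) (hy : y * h = q • (h * y))
    (xy : x * y = (q - 1)⁻¹ • (h - α • 1)) (yx : y * x = (q - 1)⁻¹ • (q • h - α • 1)) :
    QWeyl α q →ₐ[k] B :=
  -- The image of `e₁` is forced by `e₁ = -q/(q+1) h⁻¹ x²`. The relations are checked by moving `h`
  -- and `h⁻¹` to the left and eliminating `x y` and `y x`.
  RingQuot.liftAlgHom k ⟨FreeAlgebra.lift k ![(-q / (q + 1)) • (hi * (x * x)), y, x], by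
    have hq3 := sub_ne_zero.2 hq1
    have hx' : x * h = q⁻¹ • (h * x) := by rw [hx, smul_smul, inv_mul_cancel₀ hq, one_smul]
    have xhi : x * hi = q • (hi * x) := by
      calc x * hi = hi * (h * x) * hi := by rw [← mul_assoc, hih, one_mul]
        _ = q • (hi * x) := by
          rw [hx, mul_smul_comm, smul_mul_assoc, mul_assoc, mul_assoc, hhi, mul_one]
    have yhi : y * hi = q⁻¹ • (hi * y) := by
      calc y * hi = q⁻¹ • (hi * (q • (h * y)) * hi) := by
            rw [mul_smul_comm, smul_mul_assoc, smul_smul, inv_mul_cancel₀ hq, one_smul,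
              ← mul_assoc, hih, one_mul]
        _ = q⁻¹ • (hi * y) := by rw [← hy, mul_assoc, mul_assoc, hhi, mul_one]
    have a2 : ∀ z, x * (hi * z) = q • (hi * (x * z)) := fun z => by
      rw [← mul_assoc, xhi, smul_mul_assoc, mul_assoc]
    have a3 : ∀ z, y * (hi * z) = q⁻¹ • (hi * (y * z)) := fun z => by
      rw [← mul_assoc, yhi, smul_mul_assoc, mul_assoc]
    have a4 : ∀ z, y * (x * z) = (q - 1)⁻¹ • (q • (h * z) - α • z) := fun z => by
      rw [← mul_assoc, yx, smul_mul_assoc, sub_mul, smul_mul_assoc, smul_mul_assoc, one_mul]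
    have a5 : ∀ z, hi * (h * z) = z := fun z => by rw [← mul_assoc, hih, one_mul]
    intro a b hab
    cases hab <;>
    simp only [map_mul, map_smul, map_add, map_sub, map_zero, map_one,
      FreeAlgebra.lift_ι_apply, Matrix.cons_val, Algebra.algebraMap_eq_smul_one, pow_two,
      mul_add, add_mul, mul_sub, sub_mul, smul_sub, smul_smul,
      smul_mul_assoc, mul_smul_comm, mul_one, one_mul, mul_assoc, hx', xy, yx, a2, a3, a4, a5] <;>
    match_scalars <;> field_simp <;> ring⟩

end QWeyl

/-! ### Weight vectors and a spanning set -/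

namespace QWeyl

variable {k : Type*} [Field k] {α q : k}

lemma weightElt_natCast (m : ℕ) : weightElt α q m = gen α q 2 ^ m := rfl

@[simp] lemma weightElt_zero : weightElt α q 0 = 1 := by
  simpa using weightElt_natCast (α := α) (q := q) 0

lemma weightElt_neg_natCast (m : ℕ) : weightElt α q (-m) = gen α q 1 ^ m := by
  cases m with
  | zero => simp
  | succ m => rfl

@[simp] lemma weightElt_one : weightElt α q 1 = gen α q 2 := by
  simpa using weightElt_natCast (α := α) (q := q) 1

@[simp] lemma weightElt_neg_one : weightElt α q (-1) = gen α q 1 := by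
  simpa using weightElt_neg_natCast (α := α) (q := q) 1

lemma normalElt_mul_weightElt (hq : q ≠ 0) (d : ℤ) :
    normalElt α q * weightElt α q d = q ^ d • (weightElt α q d * normalElt α q) := by
  obtain ⟨m, rfl | rfl⟩ := d.eq_nat_or_neg
  · rw [weightElt_natCast]
    induction m with
    | zero => simp
    | succ m ih =>
      rw [pow_succ, ← mul_assoc, ih, smul_mul_assoc, mul_assoc, normalElt_mul_gen_two,
        mul_smul_comm, smul_smul, mul_assoc, Nat.cast_succ, zpow_add₀ hq, zpow_one]
  · rw [weightElt_neg_natCast]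
    have hy : normalElt α q * gen α q 1 = q⁻¹ • (gen α q 1 * normalElt α q) := by
      rw [gen_one_mul_normalElt, smul_smul, inv_mul_cancel₀ hq, one_smul]
    induction m with
    | zero => simp
    | succ m ih =>
      rw [pow_succ, ← mul_assoc, ih, smul_mul_assoc, mul_assoc, hy,
        mul_smul_comm, smul_smul, mul_assoc, Nat.cast_succ, neg_add, zpow_add₀ hq, zpow_neg_one]

lemma mul_normalUnit_zpow (hα : α ≠ 0) (hq : q ≠ 0) {z : QWeyl α q} {c : k} (hc : c ≠ 0)
    (hz : z * normalElt α q = c • (normalElt α q * z)) (a : ℤ) :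
    z * ↑(normalUnit hα hq ^ a) = c ^ a • (↑(normalUnit hα hq ^ a) * z) := by
  let cu : (QWeyl α q)ˣ := Units.map (algebraMap k (QWeyl α q)).toMonoidHom (Units.mk0 c hc)
  have h : SemiconjBy z ↑(normalUnit hα hq) ↑(cu * normalUnit hα hq) := by
    change z * normalElt α q = algebraMap k _ c * normalElt α q * z
    rw [hz, Algebra.smul_def, mul_assoc]
  have hcomm : Commute cu (normalUnit hα hq) := Units.ext (Algebra.commutes c (normalElt α q))
  have hcu : ((cu ^ a : (QWeyl α q)ˣ) : QWeyl α q) = algebraMap k _ (c ^ a) := by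
    rw [show cu ^ a = Units.map (algebraMap k (QWeyl α q)).toMonoidHom (Units.mk0 c hc ^ a) from
      (map_zpow _ _ _).symm, Units.coe_map, Units.val_zpow_eq_zpow_val]
    rfl
  have := h.units_zpow_right a
  rw [SemiconjBy, hcomm.mul_zpow, Units.val_mul, hcu, mul_assoc, ← Algebra.smul_def] at this
  exact this

/-- The basis elements `h ^ a x ^ d` and `h ^ a y ^ (-d)`. -/
noncomputable def basisElt (hα : α ≠ 0) (hq : q ≠ 0) (p : ℤ × ℤ) : QWeyl α q :=
  ↑(normalUnit hα hq ^ p.1) * weightElt α q p.2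

/-- The span contains `1` and is stable under left multiplication by `x` and `y`: both commute with
powers of `h` up to scalars, and `x y`, `y x` are affine in `h`. Stability under `e₁` follows from
its expression in `h⁻¹` and `x`. -/
lemma span_basisElt (hα : α ≠ 0) (hq : q ≠ 0) (hq1 : q ≠ 1) (hq2 : q + 1 ≠ 0) :
    Submodule.span k (Set.range (basisElt hα hq)) = ⊤ := by
  set S := Submodule.span k (Set.range (basisElt hα hq)) with hS
  have mem (a d : ℤ) : (↑(normalUnit hα hq ^ a) * weightElt α q d : QWeyl α q) ∈ S :=
    Submodule.subset_span ⟨(a, d), rfl⟩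
  have mul_mem (t : QWeyl α q)
      (ht : ∀ a d : ℤ, t * (↑(normalUnit hα hq ^ a) * weightElt α q d) ∈ S) : ∀ z ∈ S, t * z ∈ S := by
    intro z hz
    induction hz using Submodule.span_induction with
    | mem _ h => obtain ⟨p, rfl⟩ := h; exact ht _ _
    | zero => simp
    | add _ _ _ _ h h' => rw [mul_add]; exact S.add_mem h h'
    | smul c _ _ h => rw [mul_smul_comm]; exact S.smul_mem c h
  have unit_mem (b : ℤ) : ∀ z ∈ S, (↑(normalUnit hα hq ^ b) : QWeyl α q) * z ∈ S :=
    mul_mem _ fun a d => by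
      rw [← mul_assoc, ← Units.val_mul, ← zpow_add]; exact mem _ _
  have h_mem : ∀ z ∈ S, normalElt α q * z ∈ S := by
    simpa [normalUnit] using unit_mem 1
  have hi_mem : ∀ z ∈ S, normalInv α q * z ∈ S := by
    simpa [normalUnit] using unit_mem (-1)
  have w_mem (d : ℤ) : weightElt α q d ∈ S := by simpa using mem 0 d
  have x_mem : ∀ z ∈ S, gen α q 2 * z ∈ S := by
    refine mul_mem _ fun a d => ?_
    rw [← mul_assoc, mul_normalUnit_zpow hα hq (inv_ne_zero hq)
      (by rw [normalElt_mul_gen_two, smul_smul, inv_mul_cancel₀ hq, one_smul]),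
      smul_mul_assoc, mul_assoc]
    refine S.smul_mem _ (unit_mem _ _ ?_)
    obtain ⟨m, rfl | rfl⟩ := d.eq_nat_or_neg
    · rw [weightElt_natCast, ← pow_succ', ← weightElt_natCast]
      exact w_mem _
    · cases m with
      | zero => simpa using w_mem 1
      | succ m =>
        rw [weightElt_neg_natCast, pow_succ', ← mul_assoc, gen_two_mul_gen_one hq1,
          smul_mul_assoc, sub_mul, smul_mul_assoc, one_mul, ← weightElt_neg_natCast]
        exact S.smul_mem _ (S.sub_mem (h_mem _ (w_mem _)) (S.smul_mem _ (w_mem _)))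
  have y_mem : ∀ z ∈ S, gen α q 1 * z ∈ S := by
    refine mul_mem _ fun a d => ?_
    rw [← mul_assoc, mul_normalUnit_zpow hα hq hq gen_one_mul_normalElt, smul_mul_assoc, mul_assoc]
    refine S.smul_mem _ (unit_mem _ _ ?_)
    obtain ⟨m, rfl | rfl⟩ := d.eq_nat_or_neg
    · cases m with
      | zero => simpa using w_mem (-1)
      | succ m =>
        rw [weightElt_natCast, pow_succ', ← mul_assoc, gen_one_mul_gen_two hq1,
          smul_mul_assoc, sub_mul, smul_mul_assoc, smul_mul_assoc, one_mul, ← weightElt_natCast]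
        exact S.smul_mem _ (S.sub_mem (S.smul_mem _ (h_mem _ (w_mem _))) (S.smul_mem _ (w_mem _)))
    · rw [weightElt_neg_natCast, ← pow_succ', ← weightElt_neg_natCast]
      exact w_mem _
  refine eq_top_of_gen_mul_mem (by simpa using w_mem 0) fun i z hz => ?_
  fin_cases i
  · change gen α q 0 * z ∈ S
    rw [gen_zero_eq hα hq hq2, smul_mul_assoc, mul_assoc, mul_assoc]
    exact S.smul_mem _ (hi_mem _ (x_mem _ (x_mem _ hz)))
  · exact y_mem z hz
  · exact x_mem z hz

section Lift

variable {B : Type*} [Ring B] [Algebra k B] (hq : q ≠ 0) (hq1 : q ≠ 1)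
    (hq2 : q + 1 ≠ 0) (h hi x y : B) (hhi : h * hi = 1) (hih : hi * h = 1)
    (hx : h * x = q • (x * h)) (hy : y * h = q • (h * y))
    (xy : x * y = (q - 1)⁻¹ • (h - α • 1)) (yx : y * x = (q - 1)⁻¹ • (q • h - α • 1))

lemma lift_gen (i : Fin 3) : lift hq hq1 hq2 h hi x y hhi hih hx hy xy yx (gen α q i) =
    ![(-q / (q + 1)) • (hi * (x * x)), y, x] i := by
  refine (RingQuot.liftAlgHom_mkAlgHom_apply k _ _ _).trans ?_
  rw [FreeAlgebra.lift_ι_apply]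

lemma lift_normalElt : lift hq hq1 hq2 h hi x y hhi hih hx hy xy yx (normalElt α q) = h := by
  have := sub_ne_zero.2 hq1
  rw [normalElt, map_add, map_smul, map_mul, lift_gen, lift_gen, map_smul, map_one]
  simp only [Matrix.cons_val]
  rw [xy, smul_smul, mul_inv_cancel₀ this, one_smul, sub_add_cancel]

end Lift

end QWeyl

namespace QuantumTorus

variable {k : Type*} [Field k] {q : kˣ} {ι : Type*} [Fintype ι]

lemma mono_commute {g g' : (ι → ℤ) × (ι → ℤ)} (h : g.1 ⬝ᵥ g'.2 = g'.1 ⬝ᵥ g.2) :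
    Commute (mono q g) (mono q g') := by
  rw [Commute, SemiconjBy, mono_mul_mono, mono_mul_mono, h, add_comm]

lemma mono_mul_mono_zero (a : ι → ℤ) (g : (ι → ℤ) × (ι → ℤ)) :
    mono q g * mono q (a, 0) = mono q (g + (a, 0)) := by
  simp [mono_mul_mono]

end QuantumTorus

/-! ### Homomorphisms out of tensor products of noncommutative algebras -/

namespace PiTensorProduct

variable {k : Type*} [Field k] {ι : Type*} [Fintype ι] [DecidableEq ι] {A : ι → Type*}
  [∀ i, Ring (A i)] [∀ i, Algebra k (A i)] {B : Type*} [Ring B] [Algebra k B]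

/-- Isolating one slot as a right factor reduces multilinearity of the product map to linearity of
`f i`. -/
lemma noncommPiCoprod_update (f : ∀ i, A i →ₐ[k] B)
    (hf : Pairwise fun i j => ∀ x y, Commute ((f i : A i →* B) x) ((f j : A j →* B) y))
    (m : ∀ i, A i) (i : ι) (z : A i) :
    MonoidHom.noncommPiCoprod (fun i => (f i : A i →* B)) hf (Function.update m i z) =
      MonoidHom.noncommPiCoprod (fun i => (f i : A i →* B)) hf (Function.update m i 1) * f i z := by
  have h : Function.update m i z = Function.update m i 1 * Pi.mulSingle i z := by
    ext l
    obtain rfl | h := eq_or_ne l i <;> simp [*]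
  rw [h, map_mul, MonoidHom.noncommPiCoprod_mulSingle]
  rfl

/-- The algebra homomorphism on a tensor product induced by algebra homomorphisms on the factors
with commuting images. -/
noncomputable def noncommLift (f : ∀ i, A i →ₐ[k] B)
    (hf : Pairwise fun i j => ∀ x y, Commute (f i x) (f j y)) : (⨂[k] i, A i) →ₐ[k] B :=
  liftAlgHom
    (MultilinearMap.mk' (MonoidHom.noncommPiCoprod (fun i => (f i : A i →* B)) hf)
      (fun m i z w => by
        rw [noncommPiCoprod_update f hf, map_add, mul_add, ← noncommPiCoprod_update f hf,
          ← noncommPiCoprod_update f hf])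
      (fun m i c z => by
        rw [noncommPiCoprod_update f hf, map_smul, mul_smul_comm, ← noncommPiCoprod_update f hf]))
    (map_one (MonoidHom.noncommPiCoprod (fun i => (f i : A i →* B)) hf))
    (map_mul (MonoidHom.noncommPiCoprod (fun i => (f i : A i →* B)) hf))

lemma noncommLift_single (f : ∀ i, A i →ₐ[k] B)
    (hf : Pairwise fun i j => ∀ x y, Commute (f i x) (f j y)) (i : ι) (z : A i) :
    noncommLift f hf (singleAlgHom i z) = f i z :=
  (lift.tprod _).trans
    (MonoidHom.noncommPiCoprod_mulSingle (fun i => (f i : A i →* B)) (hcomm := hf) i z)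

lemma tprod_mem_of_single_mem {C : Submonoid (⨂[k] i, A i)} {f : ∀ i, A i}
    (h : ∀ i, singleAlgHom (R := k) i (f i) ∈ C) : tprod k f ∈ C :=
  Submonoid.pi_mem_of_mulSingle_mem (H := C.comap (tprodMonoidHom k)) f h

lemma eq_top_of_single_mem {C : Subalgebra k (⨂[k] i, A i)}
    (h : ∀ i z, singleAlgHom (R := k) i z ∈ C) : C = ⊤ := by
  rw [← Algebra.toSubmodule_eq_top, ← top_le_iff, ← span_tprod_eq_top, Submodule.span_le]
  rintro _ ⟨f, rfl⟩
  exact tprod_mem_of_single_mem (C := C.toSubmonoid) fun i => h i _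

end PiTensorProduct

/-! ### The embedding in the quantum torus -/

open QuantumTorus

namespace QWeyl

variable {k : Type*} [Field k] {q : kˣ} {ι : Type*} [Fintype ι] [DecidableEq ι]

/-- The embedding of `𝒜_{α,q}` in the `i`-th factor of the quantum torus. -/
noncomputable def toTorus {α : k} (hα : α ≠ 0) (hq1 : (q : k) ≠ 1) (hq2 : (q : k) + 1 ≠ 0) (i : ι) :
    QWeyl α (q : k) →ₐ[k] QuantumTorus q ι :=
  have hq3 := sub_ne_zero.2 hq1
  lift q.ne_zero hq1 hq2 (α • mono q (Pi.single i 1, 0)) (α⁻¹ • mono q (-Pi.single i 1, 0))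
    (mono q (0, Pi.single i 1))
    ((α / (q - 1)) • (mono q (Pi.single i 1, -Pi.single i 1) - mono q (0, -Pi.single i 1)))
    (by
      rw [smul_mul_smul_comm, mono_mul_mono_zero, mul_inv_cancel₀ hα]
      simp [one_def]
      rfl)
    (by
      rw [smul_mul_smul_comm, mono_mul_mono_zero, inv_mul_cancel₀ hα]
      simp [one_def]
      rfl)
    (by
      rw [smul_mul_assoc, mul_smul_comm, mono_mul_mono_zero, mono_mul_mono]
      simp
      module)
    (by
      simp only [smul_mul_assoc, mul_smul_comm, mul_sub, sub_mul, mono_mul_mono]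
      simp
      match_scalars <;> field_simp)
    (by
      simp only [mul_smul_comm, mul_sub, mono_mul_mono]
      simp [one_def]
      match_scalars <;> field_simp)
    (by
      simp only [smul_mul_assoc, sub_mul, mono_mul_mono]
      simp [one_def]
      match_scalars <;> field_simp)

section

variable {α : k} (hα : α ≠ 0) (hq1 : (q : k) ≠ 1) (hq2 : (q : k) + 1 ≠ 0) (i : ι)

lemma toTorus_normalElt :
    toTorus hα hq1 hq2 i (normalElt α (q : k)) = α • mono q (Pi.single i 1, 0) :=
  by rw [toTorus, lift_normalElt]

lemma toTorus_gen_one : toTorus hα hq1 hq2 i (gen α (q : k) 1) =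
    (α / (q - 1)) • (mono q (Pi.single i 1, -Pi.single i 1) - mono q (0, -Pi.single i 1)) :=
  by rw [toTorus, lift_gen]; rfl

lemma toTorus_gen_two :
    toTorus hα hq1 hq2 i (gen α (q : k) 2) = mono q (0, Pi.single i 1) :=
  by rw [toTorus, lift_gen]; rfl

/-- Up to scalars the three elements are the images of `h⁻¹`, `x` and `y`. Since `e₁` is a multiple
of `h⁻¹ x²`, these suffice. -/
lemma range_toTorus_le {C : Subalgebra k (QuantumTorus q ι)}
    (h1 : mono q (-Pi.single i 1, 0) ∈ C) (h2 : mono q (0, Pi.single i 1) ∈ C)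
    (h3 : mono q (Pi.single i 1, -Pi.single i 1) - mono q (0, -Pi.single i 1) ∈ C) :
    (toTorus hα hq1 hq2 i).range ≤ C := by
  refine range_le_of_gen_mem _ fun j => ?_
  fin_cases j
  · change toTorus hα hq1 hq2 i (gen α (q : k) 0) ∈ C
    rw [toTorus, lift_gen]
    exact C.smul_mem (C.mul_mem (C.smul_mem h1 _) (C.mul_mem h2 h2)) _
  · change toTorus hα hq1 hq2 i (gen α (q : k) 1) ∈ C
    rw [toTorus_gen_one]
    exact C.smul_mem h3 _
  · change toTorus hα hq1 hq2 i (gen α (q : k) 2) ∈ C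
    rw [toTorus_gen_two]
    exact h2

lemma commute_toTorus_of_commute {p : QuantumTorus q ι}
    (h1 : Commute p (mono q (-Pi.single i 1, 0))) (h2 : Commute p (mono q (0, Pi.single i 1)))
    (h3 : Commute p (mono q (Pi.single i 1, -Pi.single i 1)))
    (h4 : Commute p (mono q (0, -Pi.single i 1))) (z : QWeyl α (q : k)) :
    Commute p (toTorus hα hq1 hq2 i z) := by
  have : (toTorus hα hq1 hq2 i).range ≤ Subalgebra.centralizer k {p} := by
    refine range_toTorus_le hα hq1 hq2 i ?_ ?_ ?_ <;>
      rw [Subalgebra.mem_centralizer_iff] <;> rintro _ rfl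
    exacts [h1, h2, h3.sub_right h4]
  exact (Subalgebra.mem_centralizer_iff k).1 (this ⟨z, rfl⟩) p rfl

end

lemma toTorus_commute {α β : k} (hα : α ≠ 0) (hβ : β ≠ 0) (hq1 : (q : k) ≠ 1)
    (hq2 : (q : k) + 1 ≠ 0) {i j : ι} (hij : i ≠ j) (z : QWeyl α (q : k)) (w : QWeyl β (q : k)) :
    Commute (toTorus hα hq1 hq2 i z) (toTorus hβ hq1 hq2 j w) := by
  apply commute_toTorus_of_commute <;> refine Commute.symm ?_ <;>
    apply commute_toTorus_of_commute <;> apply mono_commute <;> simp [hij, hij.symm]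

variable {α : ι → k}

lemma pairwise_commute_toTorus (hα : ∀ i, α i ≠ 0) (hq1 : (q : k) ≠ 1) (hq2 : (q : k) + 1 ≠ 0) :
    Pairwise fun i j => ∀ (z : QWeyl (α i) (q : k)) (w : QWeyl (α j) (q : k)),
      Commute (toTorus (hα i) hq1 hq2 i z) (toTorus (hα j) hq1 hq2 j w) :=
  fun i j hij => toTorus_commute (hα i) (hα j) hq1 hq2 hij

/-- The embedding of the tensor product of the `𝒜_{α i,q}` in the quantum torus. -/
noncomputable def tensorToTorus (hα : ∀ i, α i ≠ 0) (hq1 : (q : k) ≠ 1) (hq2 : (q : k) + 1 ≠ 0) :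
    (⨂[k] i, QWeyl (α i) (q : k)) →ₐ[k] QuantumTorus q ι :=
  PiTensorProduct.noncommLift (fun i => toTorus (hα i) hq1 hq2 i)
    (pairwise_commute_toTorus hα hq1 hq2)

lemma tensorToTorus_single (hα : ∀ i, α i ≠ 0) (hq1 : (q : k) ≠ 1) (hq2 : (q : k) + 1 ≠ 0) (i : ι)
    (z : QWeyl (α i) (q : k)) :
    tensorToTorus hα hq1 hq2 (PiTensorProduct.singleAlgHom (R := k) i z) = toTorus (hα i) hq1 hq2 i z :=
  PiTensorProduct.noncommLift_single (fun i => toTorus (hα i) hq1 hq2 i)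
    (pairwise_commute_toTorus hα hq1 hq2) i z

end QWeyl

/-! ### Projections onto sets of exponents -/

namespace QuantumTorus

variable {k : Type*} [Field k] {q : kˣ} {ι : Type*}

open scoped Classical in
/-- The projection on the span of the monomials whose exponents satisfy `P`. -/
noncomputable def proj (P : (ι → ℤ) × (ι → ℤ) → Prop) : QuantumTorus q ι →ₗ[k] QuantumTorus q ι :=
  linearLift fun g => if P g then mono q g else 0

lemma proj_eq_self {P : (ι → ℤ) × (ι → ℤ) → Prop} {p : QuantumTorus q ι}
    (h : ∀ g ∈ p.coeff.support, P g) : proj P p = p := by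
  have h1 := congrArg (proj P) (eq_sum_mono p)
  rw [map_sum] at h1
  refine h1.trans (Eq.trans (Finset.sum_congr rfl fun g hg => ?_) (eq_sum_mono p).symm)
  rw [map_smul, proj, linearLift_mono, if_pos (h g hg)]

lemma proj_eq_zero {P : (ι → ℤ) × (ι → ℤ) → Prop} {p : QuantumTorus q ι}
    (h : ∀ g ∈ p.coeff.support, ¬ P g) : proj P p = 0 := by
  rw [eq_sum_mono p, map_sum]
  refine Finset.sum_eq_zero fun g hg => ?_
  rw [map_smul, proj, linearLift_mono, if_neg (h g hg), smul_zero]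

lemma exists_of_mem_support_mul [Fintype ι] {p p' : QuantumTorus q ι} {g : (ι → ℤ) × (ι → ℤ)}
    (h : g ∈ (p * p').coeff.support) :
    ∃ a ∈ p.coeff.support, ∃ b ∈ p'.coeff.support, a + b = g := by
  classical
  rw [Finsupp.mem_support_iff, coeff_mul] at h
  obtain ⟨x, hx, hne⟩ := Finset.exists_ne_zero_of_sum_ne_zero h
  rw [Finset.mem_product] at hx
  refine ⟨x.1, hx.1, x.2, hx.2, ?_⟩
  by_contra hn
  exact hne (if_neg hn)

lemma eq_of_mem_support_smul_mono {a : k} {g g' : (ι → ℤ) × (ι → ℤ)}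
    (h : g ∈ (a • mono q g').coeff.support) : g = g' := by
  classical
  rw [Finsupp.mem_support_iff, coeff_smul, coeff_mono, Finsupp.smul_apply,
    Finsupp.single_apply] at h
  by_contra hn
  exact h (by rw [if_neg (Ne.symm hn), smul_zero])

end QuantumTorus

/-! ### Injectivity of homomorphisms to the torus -/

namespace QWeyl

variable {k : Type*} [Field k] {q : kˣ} {ι : Type*} [Fintype ι] [DecidableEq ι] {α : ι → k}

/-- The tensors `h ^ a`. -/
noncomputable def torusTensor (hα : ∀ i, α i ≠ 0) (a : ι → ℤ) : ⨂[k] i, QWeyl (α i) (q : k) :=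
  PiTensorProduct.tprod k fun i => ↑(normalUnit (hα i) q.ne_zero ^ a i)

/-- The tensor products of weight vectors. -/
noncomputable def weightTensor (q : kˣ) (α : ι → k) (d : ι → ℤ) : ⨂[k] i, QWeyl (α i) (q : k) :=
  PiTensorProduct.tprod k fun i => weightElt (α i) (q : k) (d i)

omit [Fintype ι] [DecidableEq ι] in
lemma torusTensor_add (hα : ∀ i, α i ≠ 0) (a b : ι → ℤ) :
    torusTensor (q := q) hα (a + b) = torusTensor hα a * torusTensor hα b := by
  rw [torusTensor, torusTensor, torusTensor, PiTensorProduct.tprod_mul_tprod]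
  congr 1
  ext i
  simp [zpow_add]

omit [Fintype ι] [DecidableEq ι] in
lemma torusTensor_zero (hα : ∀ i, α i ≠ 0) : torusTensor (q := q) hα 0 = 1 := by
  rw [torusTensor, PiTensorProduct.one_def]
  congr 1
  ext i
  simp

omit [Fintype ι] in
lemma torusTensor_single_one (hα : ∀ i, α i ≠ 0) (i : ι) : torusTensor (q := q) hα (Pi.single i 1) =
    PiTensorProduct.singleAlgHom (R := k) i (normalElt (α i) (q : k)) := by
  rw [torusTensor, PiTensorProduct.singleAlgHom_apply]
  congr 1
  ext l
  obtain rfl | h := eq_or_ne l i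
  · simp [normalUnit]
  · simp [h]

omit [Fintype ι] in
lemma weightTensor_single (i : ι) (d : ℤ) : weightTensor q α (Pi.single i d) =
    PiTensorProduct.singleAlgHom (R := k) i (weightElt (α i) (q : k) d) := by
  rw [weightTensor, PiTensorProduct.singleAlgHom_apply]
  congr 1
  ext l
  obtain rfl | h := eq_or_ne l i
  · simp
  · simp [h]

omit [Fintype ι] in
lemma single_normalElt_mul_weightTensor (i : ι) (d : ι → ℤ) :
    PiTensorProduct.singleAlgHom (R := k) i (normalElt (α i) (q : k)) * weightTensor q α d =
      ((q ^ d i : kˣ) : k) • (weightTensor q α d *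
        PiTensorProduct.singleAlgHom (R := k) i (normalElt (α i) (q : k))) := by
  rw [weightTensor, PiTensorProduct.singleAlgHom_apply, PiTensorProduct.tprod_mul_tprod,
    PiTensorProduct.tprod_mul_tprod]
  set w := fun l => weightElt (α l) (q : k) (d l) with hw
  have h1 : MonoidHom.mulSingle (fun l => QWeyl (α l) (q : k)) i (normalElt (α i) (q : k)) * w =
      Function.update w i (normalElt (α i) (q : k) * w i) := by
    ext l
    obtain rfl | h := eq_or_ne l i <;> simp [*]
  have h2 : w * MonoidHom.mulSingle (fun l => QWeyl (α l) (q : k)) i (normalElt (α i) (q : k)) =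
      Function.update w i (w i * normalElt (α i) (q : k)) := by
    ext l
    obtain rfl | h := eq_or_ne l i <;> simp [*]
  rw [h1, h2, hw, normalElt_mul_weightElt q.ne_zero, MultilinearMap.map_update_smul,
    Units.val_zpow_eq_zpow_val]

omit [DecidableEq ι] in
lemma span_torusTensor_mul_weightTensor (hα : ∀ i, α i ≠ 0) (hq1 : (q : k) ≠ 1)
    (hq2 : (q : k) + 1 ≠ 0) :
    Submodule.span k (Set.range fun p : (ι → ℤ) × (ι → ℤ) =>
      torusTensor (q := q) hα p.1 * weightTensor q α p.2) = ⊤ := by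
  rw [← PiTensorProduct.submodule_span_eq_top fun i => span_basisElt (hα i) q.ne_zero hq1 hq2]
  congr 1
  ext t
  constructor
  · rintro ⟨p, rfl⟩
    refine ⟨fun i => (p.1 i, p.2 i), ?_⟩
    simp only [torusTensor, weightTensor, PiTensorProduct.tprod_mul_tprod]
    rfl
  · rintro ⟨j, rfl⟩
    refine ⟨(fun i => (j i).1, fun i => (j i).2), ?_⟩
    simp only [torusTensor, weightTensor, PiTensorProduct.tprod_mul_tprod]
    rfl

section Hom

variable (hα : ∀ i, α i ≠ 0) {ψ : (⨂[k] i, QWeyl (α i) (q : k)) →ₐ[k] QuantumTorus q ι}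
  {M : Matrix ι ι ℤ} {c : ι → k} (hc : ∀ i, c i ≠ 0)
  (hψ : ∀ i, ψ (PiTensorProduct.singleAlgHom (R := k) i (normalElt (α i) (q : k))) =
    c i • mono q (M i, 0))

include hc hψ

lemma exists_map_torusTensor (a : ι → ℤ) :
    ∃ b : k, b ≠ 0 ∧ ψ (torusTensor hα a) = b • mono q (Matrix.vecMul a M, 0) := by
  -- The exponents with the required property form a subgroup of the lattice, so it is enough to
  -- treat unit vectors.
  let S : AddSubgroup (ι → ℤ) :=
    { carrier := {a | ∃ b : k, b ≠ 0 ∧ ψ (torusTensor hα a) = b • mono q (Matrix.vecMul a M, 0)}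
      zero_mem' := ⟨1, one_ne_zero, by
        rw [torusTensor_zero, map_one, Matrix.zero_vecMul, one_smul, one_def]; rfl⟩
      add_mem' := by
        rintro a a' ⟨b, hb, h⟩ ⟨b', hb', h'⟩
        refine ⟨b * b', mul_ne_zero hb hb', ?_⟩
        rw [torusTensor_add, map_mul, h, h', smul_mul_smul_comm, mono_mul_mono_zero,
          Matrix.add_vecMul, Prod.mk_add_mk, add_zero]
      neg_mem' := by
        rintro a ⟨b, hb, h⟩
        refine ⟨b⁻¹, inv_ne_zero hb, ?_⟩
        have h1 : ψ (torusTensor hα (-a)) * (b • mono q (Matrix.vecMul a M, 0)) = 1 := by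
          rw [← h, ← map_mul, ← torusTensor_add, neg_add_cancel, torusTensor_zero, map_one]
        rw [← (isUnit_smul_mono hb _).mul_left_inj, h1, smul_mul_smul_comm, inv_mul_cancel₀ hb,
          mono_mul_mono_zero, Matrix.neg_vecMul, Prod.mk_add_mk, neg_add_cancel, add_zero,
          one_smul, one_def]
        rfl }
  refine AddSubgroup.pi_mem_of_single_mem (H := S) a fun i => ?_
  have h1 : Pi.single i 1 ∈ S :=
    ⟨c i, hc i, by rw [torusTensor_single_one, hψ, Matrix.single_one_vecMul]; rfl⟩
  have h2 : (Pi.single i (a i) : ι → ℤ) = a i • Pi.single i 1 := by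
    rw [← Pi.single_smul, smul_eq_mul, mul_one]
  rw [h2]
  exact S.zsmul_mem h1 _

/-- Since `h = y x - x y`, killing `x` or `y` would kill `h`, whose image is a unit. -/
lemma map_single_gen_ne_zero (hq1 : (q : k) ≠ 1) (i : ι) :
    ψ (PiTensorProduct.singleAlgHom (R := k) i (gen (α i) (q : k) 1)) ≠ 0 ∧
      ψ (PiTensorProduct.singleAlgHom (R := k) i (gen (α i) (q : k) 2)) ≠ 0 := by
  have h : normalElt (α i) (q : k) = gen (α i) (q : k) 1 * gen (α i) (q : k) 2
      - gen (α i) (q : k) 2 * gen (α i) (q : k) 1 := by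
    have := sub_ne_zero.2 hq1
    rw [gen_one_mul_gen_two hq1, gen_two_mul_gen_one hq1]
    match_scalars <;> field_simp
    ring
  have hne := hψ i ▸ (isUnit_smul_mono (hc i) (M i, 0)).ne_zero
  constructor <;> intro h0 <;> apply hne <;> rw [h] <;> simp only [map_sub, map_mul, h0] <;> simp

lemma map_weightTensor_ne_zero (hq1 : (q : k) ≠ 1) (d : ι → ℤ) :
    ψ (weightTensor q α d) ≠ 0 := by
  have h := map_single_gen_ne_zero hc hψ hq1
  refine PiTensorProduct.tprod_mem_of_single_mem
    (C := (nonZeroDivisors (QuantumTorus q ι)).comap ψ) (fun i => ?_) |> nonZeroDivisors.ne_zero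
  refine mem_nonZeroDivisors_of_ne_zero ?_
  obtain ⟨m, hm | hm⟩ := (d i).eq_nat_or_neg
  · rw [hm, weightElt_natCast, map_pow, map_pow]
    exact pow_ne_zero _ (h i).2
  · rw [hm, weightElt_neg_natCast, map_pow, map_pow]
    exact pow_ne_zero _ (h i).1

/-- The weight vector `q`-commutes with `hᵢ` with exponent `d i`. Its image therefore `q`-commutes
in the same way with `h^(M i)`, which fixes `M i ⬝ᵥ g.2`. -/
lemma dotProduct_of_mem_support_map (hq : ∀ m : ℤ, q ^ m = 1 → m = 0) {d : ι → ℤ}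
    {g : (ι → ℤ) × (ι → ℤ)} (hg : g ∈ (ψ (weightTensor q α d)).coeff.support) :
    Matrix.mulVec M g.2 = d := by
  ext i
  refine dotProduct_eq_of_mono_mul hq ?_ hg
  have := congrArg ψ (single_normalElt_mul_weightTensor (q := q) (α := α) i d)
  rw [map_mul, map_smul, map_mul, hψ, smul_mul_assoc, mul_smul_comm, smul_comm] at this
  exact smul_right_injective _ (hc i) this

/-- The image of `xᵢ` is nonzero, so it has some exponent, whose `x`-part is sent by `M` to the
`i`-th unit vector. These vectors are the columns of `D`. -/
lemma exists_mul_eq_one (hq : ∀ m : ℤ, q ^ m = 1 → m = 0) (hq1 : (q : k) ≠ 1) :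
    ∃ D : Matrix ι ι ℤ, M * D = 1 := by
  have (i : ι) : ∃ v, Matrix.mulVec M v = Pi.single i 1 := by
    obtain ⟨g, hg⟩ := Finsupp.support_nonempty_iff.2
      (coeff_eq_zero.not.2 (map_weightTensor_ne_zero hc hψ hq1 (Pi.single i 1)))
    exact ⟨g.2, dotProduct_of_mem_support_map hc hψ hq hg⟩
  choose D hD using this
  refine ⟨(Matrix.of D).transpose, ?_⟩
  ext i j
  have := congrFun (hD j) i
  rw [Matrix.mul_apply', Matrix.one_apply]
  rw [Pi.single_apply] at this
  exact this

/-- A homomorphism to the quantum torus that sends the normal elements to monomials is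
injective. -/
theorem injective_of_map_normalElt (hα : ∀ i, α i ≠ 0) (hq : ∀ m : ℤ, q ^ m = 1 → m = 0)
    (hq1 : (q : k) ≠ 1) (hq2 : (q : k) + 1 ≠ 0) : Function.Injective ψ := by
  obtain ⟨D, hD⟩ := exists_mul_eq_one hc hψ hq hq1
  have hM : Function.Injective fun a => Matrix.vecMul a M := by
    intro a b hab
    have := congrArg (fun v => Matrix.vecMul v D) hab
    simpa [Matrix.vecMul_vecMul, hD] using this
  rw [injective_iff_map_eq_zero]
  intro t ht
  have hspan : t ∈ Submodule.span k (Set.range fun p : (ι → ℤ) × (ι → ℤ) =>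
      torusTensor (q := q) hα p.1 * weightTensor q α p.2) :=
    span_torusTensor_mul_weightTensor hα hq1 hq2 ▸ Submodule.mem_top
  obtain ⟨l, rfl⟩ := Finsupp.mem_span_range_iff_exists_finsupp.1 hspan
  suffices l = 0 by simp [this]
  ext ⟨a₀, d₀⟩
  choose b hb hbψ using exists_map_torusTensor hα hc hψ
  rw [Finsupp.sum, map_sum] at ht
  simp only [map_smul, map_mul, hbψ] at ht
  classical
  -- The images of the different weight spaces have disjoint supports, separated by the value of `M`
  -- on the `x`-exponent. `F` isolates the weight `d₀`.
  let F : QuantumTorus q ι →ₗ[k] QuantumTorus q ι := proj fun g => Matrix.mulVec M g.2 = d₀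
  have hF (p : (ι → ℤ) × (ι → ℤ)) : F ((b p.1 • mono q (Matrix.vecMul p.1 M, 0)) *
      ψ (weightTensor q α p.2)) = if p.2 = d₀ then
        (b p.1 • mono q (Matrix.vecMul p.1 M, 0)) * ψ (weightTensor q α d₀) else 0 := by
    have hdeg : ∀ g ∈ ((b p.1 • mono q (Matrix.vecMul p.1 M, 0)) *
        ψ (weightTensor q α p.2)).coeff.support, Matrix.mulVec M g.2 = p.2 := by
      intro g hg
      obtain ⟨g', hg', g'', hg'', rfl⟩ := exists_of_mem_support_mul hg
      rw [eq_of_mem_support_smul_mono hg', Prod.snd_add, zero_add]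
      exact dotProduct_of_mem_support_map hc hψ hq hg''
    split_ifs with h
    · rw [← h]
      exact proj_eq_self fun g hg => (hdeg g hg).trans h
    · exact proj_eq_zero fun g hg h' => h ((hdeg g hg).symm.trans h')
  replace ht := congrArg F ht
  simp only [map_sum, map_smul, hF, map_zero, smul_ite, smul_zero] at ht
  rw [← Finset.sum_filter] at ht
  simp only [← smul_mul_assoc, ← Finset.sum_mul] at ht
  -- What remains is a Laurent polynomial in the `h` variables times a nonzero element, so the
  -- polynomial vanishes. Its monomials are distinct because `a ↦ a M` is injective.
  have := (mul_eq_zero.1 ht).resolve_right (map_weightTensor_ne_zero hc hψ hq1 d₀)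
  replace this := congrArg (fun p => p.coeff (Matrix.vecMul a₀ M, 0)) this
  simp only [coeff_sum, coeff_smul, coeff_mono, Finsupp.finsetSum_apply, coeff_zero] at this
  by_contra hne
  rw [Finset.sum_eq_single_of_mem (a₀, d₀) (by simpa using hne)] at this
  · simp [hb] at this
    exact hne this
  · rintro ⟨a, d⟩ had hne'
    obtain rfl : d = d₀ := (Finset.mem_filter.1 had).2
    have : a ≠ a₀ := by rintro rfl; exact hne' rfl
    simp [hM.eq_iff, this]

end Hom

end QWeyl

/-! ### Half spaces, units and weight `-eᵢ` -/

namespace QuantumTorus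

variable {k : Type*} [Field k] {q : kˣ} {ι : Type*} [Fintype ι]

/-- The elements of the quantum torus that act on the lattice preserving the half space
`0 ≤ m i`. -/
noncomputable def halfSpaceStabilizer (q : kˣ) (i : ι) : Subalgebra k (QuantumTorus q ι) where
  carrier := {p | ∀ v ∈ Finsupp.supported k k {m : ι → ℤ | 0 ≤ m i},
    latticeRep p v ∈ Finsupp.supported k k {m : ι → ℤ | 0 ≤ m i}}
  mul_mem' {p p'} hp hp' v hv := by
    rw [map_mul]
    exact hp _ (hp' v hv)
  add_mem' {p p'} hp hp' v hv := by
    rw [map_add]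
    exact Submodule.add_mem _ (hp v hv) (hp' v hv)
  algebraMap_mem' c v hv := by
    rw [AlgHom.commutes]
    exact Submodule.smul_mem _ c hv

lemma mem_halfSpaceStabilizer {i : ι} {p : QuantumTorus q ι}
    (h : ∀ m : ι → ℤ, 0 ≤ m i → latticeRep p (Finsupp.single m 1) ∈
      Finsupp.supported k k {m : ι → ℤ | 0 ≤ m i}) : p ∈ halfSpaceStabilizer q i := by
  have : Finsupp.supported k k {m : ι → ℤ | 0 ≤ m i} ≤
      (Finsupp.supported k k {m : ι → ℤ | 0 ≤ m i}).comap (latticeRep p) := by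
    conv_lhs => rw [Finsupp.supported_eq_span_single]
    rw [Submodule.span_le]
    rintro _ ⟨m, hm, rfl⟩
    exact h m hm
  exact this

/-- Every exponent of `p` pushes a wall point out of the half space, while `p` maps the half space
to itself. So nothing can survive. -/
lemma latticeRep_single_eq_zero {i : ι} {p : QuantumTorus q ι} (hp : p ∈ halfSpaceStabilizer q i)
    (hneg : ∀ g ∈ p.coeff.support, g.2 i < 0) {m : ι → ℤ} (hm : m i = 0) :
    latticeRep p (Finsupp.single m 1) = 0 := by
  ext w
  by_contra hne
  obtain ⟨g, hg, rfl⟩ := exists_mem_support_of_latticeRep hne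
  have h1 : (0 : ℤ) ≤ (m + g.2) i :=
    hp _ (Finsupp.single_mem_supported k 1 hm.ge) (Finsupp.mem_support_iff.2 hne)
  have h2 := hneg g hg
  rw [Pi.add_apply, hm] at h1
  omega

lemma latticeRep_mono_zero_single (a m : ι → ℤ) (b : k) :
    latticeRep (mono q (a, 0)) (Finsupp.single m b) = ((q ^ (a ⬝ᵥ m) : kˣ) : k) • Finsupp.single m b := by
  rw [latticeRep_mono, add_zero, Finsupp.smul_single, smul_eq_mul, mul_comm]

lemma commute_mono_zero {p : QuantumTorus q ι} (hp : ∀ g ∈ p.coeff.support, g.2 = 0) (a : ι → ℤ) :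
    Commute (mono q (a, 0)) p := by
  rw [eq_sum_mono p]
  refine Commute.sum_right _ _ _ fun g hg => Commute.smul_right (mono_commute ?_) _
  simp [hp g hg]

end QuantumTorus

namespace QWeyl

variable {k : Type*} [Field k] {q : kˣ} {ι : Type*} [Fintype ι] [DecidableEq ι] {α : ι → k}

section Tensor

variable (hα : ∀ i, α i ≠ 0) (hq1 : (q : k) ≠ 1) (hq2 : (q : k) + 1 ≠ 0)

lemma tensorToTorus_normalElt (i : ι) : tensorToTorus hα hq1 hq2
    (PiTensorProduct.singleAlgHom (R := k) i (normalElt (α i) (q : k))) =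
      α i • mono q ((1 : Matrix ι ι ℤ) i, 0) := by
  rw [tensorToTorus_single, toTorus_normalElt]
  congr 3
  ext j
  rw [Matrix.one_apply, Pi.single_apply]
  simp only [eq_comm]

/-- Only `yᵢ` lowers the `i`-th coordinate, and it acts at `m` with a factor proportional to `q ^ m
i - 1`, which vanishes exactly where the shift would leave the half space. -/
lemma tensorToTorus_mem_halfSpaceStabilizer (t : ⨂[k] i, QWeyl (α i) (q : k)) (i : ι) :
    tensorToTorus hα hq1 hq2 t ∈ halfSpaceStabilizer q i := by
  have key : (halfSpaceStabilizer q i).comap (tensorToTorus hα hq1 hq2) = ⊤ := by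
    refine PiTensorProduct.eq_top_of_single_mem fun l z => ?_
    rw [Subalgebra.mem_comap, tensorToTorus_single]
    refine range_toTorus_le (hα l) hq1 hq2 l ?_ ?_ ?_ ⟨z, rfl⟩ <;>
      refine mem_halfSpaceStabilizer fun m hm => ?_
    · rw [latticeRep_mono_zero_single]
      exact Submodule.smul_mem _ _ (Finsupp.single_mem_supported k 1 hm)
    · rw [latticeRep_mono]
      refine Finsupp.single_mem_supported k _ ?_
      have : (0 : ℤ) ≤ (Pi.single l 1 : ι → ℤ) i := by
        rw [Pi.single_apply]; split_ifs <;> norm_num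
      exact add_nonneg hm this
    · rw [map_sub, LinearMap.sub_apply, latticeRep_mono, latticeRep_mono, ← Finsupp.single_sub]
      by_cases h : l = i ∧ m i = 0
      · obtain ⟨rfl, h⟩ := h
        simp [h]
      · refine Finsupp.single_mem_supported k _ ?_
        change (0 : ℤ) ≤ m i + -(Pi.single l 1 : ι → ℤ) i
        rw [Pi.single_apply]
        split_ifs with h'
        · have : m i ≠ 0 := fun h0 => h ⟨h'.symm, h0⟩
          omega
        · simpa using hm
  exact key.ge (Algebra.mem_top (R := k) (x := t))

lemma snd_eq_of_mem_support (hq : ∀ m : ℤ, q ^ m = 1 → m = 0) {d : ι → ℤ}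
    {g : (ι → ℤ) × (ι → ℤ)}
    (hg : g ∈ (tensorToTorus hα hq1 hq2 (weightTensor q α d)).coeff.support) : g.2 = d := by
  have := dotProduct_of_mem_support_map hα (tensorToTorus_normalElt hα hq1 hq2) hq hg
  rwa [Matrix.one_mulVec] at this

lemma tensorToTorus_injective (hq : ∀ m : ℤ, q ^ m = 1 → m = 0) :
    Function.Injective (tensorToTorus hα hq1 hq2) :=
  injective_of_map_normalElt hα (tensorToTorus_normalElt hα hq1 hq2) hα hq hq1 hq2

lemma exists_tensorToTorus_torusTensor (a : ι → ℤ) :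
    ∃ b : k, b ≠ 0 ∧ tensorToTorus hα hq1 hq2 (torusTensor hα a) = b • mono q (a, 0) := by
  have := exists_map_torusTensor hα hα (tensorToTorus_normalElt hα hq1 hq2) a
  rwa [Matrix.vecMul_one] at this

/-- Units of the tensor product are sent to monomials in the `h` variables. -/
lemma exists_tensorToTorus_of_isUnit {t : ⨂[k] i, QWeyl (α i) (q : k)} (ht : IsUnit t) :
    ∃ c : k, c ≠ 0 ∧ ∃ a, tensorToTorus hα hq1 hq2 t = c • mono q (a, 0) := by
  have key : ∀ t : ⨂[k] i, QWeyl (α i) (q : k), IsUnit t → ∃ c : k, c ≠ 0 ∧ ∃ g,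
      tensorToTorus hα hq1 hq2 t = c • mono q g ∧ ∀ i, 0 ≤ g.2 i := by
    intro t ht
    obtain ⟨c, hc, g, hg⟩ := eq_smul_mono_of_isUnit (ht.map (tensorToTorus hα hq1 hq2))
    refine ⟨c, hc, g, hg, fun i => ?_⟩
    by_contra! hlt
    -- A negative `x`-exponent would make the monomial kill the point mass at the origin, but
    -- monomials act invertibly.
    have h0 := latticeRep_single_eq_zero (m := 0)
      (tensorToTorus_mem_halfSpaceStabilizer hα hq1 hq2 t i)
      (fun g' hg' => by rw [hg] at hg'; rwa [eq_of_mem_support_smul_mono hg']) rfl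
    rw [hg, map_smul, LinearMap.smul_apply, latticeRep_mono] at h0
    simp [hc] at h0
  obtain ⟨u, rfl⟩ := ht
  obtain ⟨c, hc, g, hg, hpos⟩ := key u u.isUnit
  obtain ⟨c', hc', g', hg', hpos'⟩ := key ↑u⁻¹ u⁻¹.isUnit
  refine ⟨c, hc, g.1, ?_⟩
  have h1 : tensorToTorus hα hq1 hq2 u * tensorToTorus hα hq1 hq2 ↑u⁻¹ = 1 := by
    rw [← map_mul, u.mul_inv, map_one]
  have h2 : (0 : (ι → ℤ) × (ι → ℤ)) = g + g' := by
    refine eq_of_mem_support_smul_mono (q := q)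
      (a := c * c' * ((q ^ (g.1 ⬝ᵥ g'.2) : kˣ) : k)) ?_
    rw [mul_smul, ← mono_mul_mono, ← smul_mul_smul_comm, ← hg, ← hg', h1, one_def]
    simp
  -- The `x`-exponents of the unit and of its inverse are both nonnegative and add up to zero.
  have h3 : g.2 = 0 := by
    ext i
    have := congrFun (congrArg Prod.snd h2) i
    have h4 := hpos i
    have h5 := hpos' i
    simp only [Prod.snd_zero, Prod.snd_add, Pi.add_apply, Pi.zero_apply] at this ⊢
    omega
  rw [hg, ← h3]

lemma tensorToTorus_single_mul (i : ι) :
    tensorToTorus hα hq1 hq2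
      (PiTensorProduct.singleAlgHom (R := k) i (gen (α i) (q : k) 2 * gen (α i) (q : k) 1)) =
      (α i / (q - 1)) • (mono q (Pi.single i 1, 0) - 1) := by
  rw [gen_two_mul_gen_one hq1, tensorToTorus_single, map_smul, map_sub, toTorus_normalElt,
    map_smul, map_one, ← smul_sub, smul_smul, div_eq_inv_mul]

/-- An element of weight `-eᵢ` is divisible by `yᵢ`. -/
lemma exists_eq_mul_of_weight_neg (hq : ∀ m : ℤ, q ^ m = 1 → m = 0) {i : ι}
    {t : ⨂[k] i, QWeyl (α i) (q : k)}
    (ht : ∀ g ∈ (tensorToTorus hα hq1 hq2 t).coeff.support, g.2 = -Pi.single i 1) :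
    ∃ G : QuantumTorus q ι, (∀ g ∈ G.coeff.support, g.2 = 0) ∧
      tensorToTorus hα hq1 hq2 t = tensorToTorus hα hq1 hq2
        (PiTensorProduct.singleAlgHom (R := k) i (gen (α i) (q : k) 1)) * G := by
  set y := tensorToTorus hα hq1 hq2
        (PiTensorProduct.singleAlgHom (R := k) i (gen (α i) (q : k) 1)) with hy
  let Z : Submodule k (QuantumTorus q ι) :=
    { carrier := {G | ∀ g ∈ G.coeff.support, g.2 = 0}
      zero_mem' := by simp
      add_mem' := by
        classical
        intro G G' h h' g hg
        obtain h1 | h1 := Finset.mem_union.1 (Finsupp.support_add hg)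
        exacts [h g h1, h' g h1]
      smul_mem' := fun c G h g hg => h g (Finsupp.support_smul hg) }
  let F : QuantumTorus q ι →ₗ[k] QuantumTorus q ι := proj fun g => g.2 = -Pi.single i 1
  -- For a general `t` it is the component of weight `-eᵢ` that is divisible by `yᵢ`; in this form
  -- the claim is linear and can be checked on the spanning set.
  have key : ∀ t, F (tensorToTorus hα hq1 hq2 t) ∈ Z.map (LinearMap.mulLeft k y) := by
    intro t
    have ht : t ∈ Submodule.span k (Set.range fun p : (ι → ℤ) × (ι → ℤ) =>
        torusTensor (q := q) hα p.1 * weightTensor q α p.2) :=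
      span_torusTensor_mul_weightTensor hα hq1 hq2 ▸ Submodule.mem_top
    induction ht using Submodule.span_induction with
    | zero => rw [map_zero, map_zero]; exact Submodule.zero_mem _
    | add _ _ _ _ h h' => rw [map_add, map_add]; exact Submodule.add_mem _ h h'
    | smul c _ _ h => rw [map_smul, map_smul]; exact Submodule.smul_mem _ c h
    | mem _ h =>
      obtain ⟨⟨a, d⟩, rfl⟩ := h
      dsimp only
      obtain ⟨b, hb, hba⟩ := exists_tensorToTorus_torusTensor hα hq1 hq2 a
      have hdeg : ∀ g ∈ (tensorToTorus hα hq1 hq2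
          (torusTensor hα a * weightTensor q α d)).coeff.support, g.2 = d := by
        intro g hg
        rw [map_mul, hba] at hg
        obtain ⟨g', hg', g'', hg'', rfl⟩ := exists_of_mem_support_mul hg
        rw [eq_of_mem_support_smul_mono hg', Prod.snd_add, zero_add]
        exact snd_eq_of_mem_support hα hq1 hq2 hq hg''
      by_cases h : d = -Pi.single i 1
      · rw [proj_eq_self fun g hg => (hdeg g hg).trans h, h, ← Pi.single_neg, map_mul,
          weightTensor_single, weightElt_neg_one, hba, ← hy]
        -- The power of `q` is the cost of moving `h ^ a` to the right of `yᵢ`.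
        refine ⟨(b * ((q ^ (-a i) : kˣ) : k)) • mono q (a, 0), fun g hg => ?_, ?_⟩
        · rw [eq_of_mem_support_smul_mono hg]
        · rw [LinearMap.mulLeft_apply, hy, tensorToTorus_single, toTorus_gen_one]
          simp only [smul_mul_assoc, mul_smul_comm, mul_sub, sub_mul, mono_mul_mono]
          simp [add_comm]
          module
      · rw [proj_eq_zero fun g hg h' => h ((hdeg g hg).symm.trans h')]
        exact Submodule.zero_mem _
  obtain ⟨G, hG, hGt⟩ := key t
  exact ⟨G, hG, (proj_eq_self ht).symm.trans hGt.symm⟩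

end Tensor

end QWeyl

/-! ### Uniqueness of the factorisation of `xᵢ yᵢ` -/

namespace QWeyl

variable {k : Type*} [Field k] {q : kˣ} {ι : Type*} [Fintype ι] [DecidableEq ι] {α : ι → k}

section Factor

variable (hα : ∀ i, α i ≠ 0) (hq1 : (q : k) ≠ 1) (hq2 : (q : k) + 1 ≠ 0)

/-- If the product of elements of weights `eᵢ` and `-eᵢ` is `xᵢ yᵢ` up to a unit, then the factors
are `xᵢ` and `yᵢ` up to units. -/
lemma exists_eq_torusTensor_mul (hq : ∀ m : ℤ, q ^ m = 1 → m = 0) {i : ι}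
    {X Y : ⨂[k] i, QWeyl (α i) (q : k)}
    (hX : ∀ g ∈ (tensorToTorus hα hq1 hq2 X).coeff.support, g.2 = Pi.single i 1)
    (hY : ∀ g ∈ (tensorToTorus hα hq1 hq2 Y).coeff.support, g.2 = -Pi.single i 1)
    {c : k} (hc : c ≠ 0) {a : ι → ℤ}
    (hXY : tensorToTorus hα hq1 hq2 (X * Y) = (c • mono q (a, 0)) * tensorToTorus hα hq1 hq2
      (PiTensorProduct.singleAlgHom (R := k) i (gen (α i) (q : k) 2 * gen (α i) (q : k) 1))) :
    (∃ b : k, b ≠ 0 ∧ ∃ a', X = b • (torusTensor hα a' *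
      PiTensorProduct.singleAlgHom (R := k) i (gen (α i) (q : k) 2))) ∧
    ∃ b : k, b ≠ 0 ∧ ∃ a', Y = b • (
      PiTensorProduct.singleAlgHom (R := k) i (gen (α i) (q : k) 1) * torusTensor hα a') := by
  have hinj := tensorToTorus_injective hα hq1 hq2 hq
  have hprod := tensorToTorus_single_mul hα hq1 hq2 i
  set x := PiTensorProduct.singleAlgHom (R := k) (A := fun i => QWeyl (α i) (q : k)) i
    (gen (α i) (q : k) 2) with hx
  set y := PiTensorProduct.singleAlgHom (R := k) (A := fun i => QWeyl (α i) (q : k)) i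
    (gen (α i) (q : k) 1) with hy
  have hjx : tensorToTorus hα hq1 hq2 x = mono q (0, Pi.single i 1) := by
    rw [hx, tensorToTorus_single, toTorus_gen_two]
  obtain ⟨G, hG, hYG⟩ := exists_eq_mul_of_weight_neg hα hq1 hq2 hq hY
  set F := tensorToTorus hα hq1 hq2 X * mono q (0, -Pi.single i 1) with hF
  have hF0 : ∀ g ∈ F.coeff.support, g.2 = 0 := by
    intro g hg
    obtain ⟨g', hg', g'', hg'', rfl⟩ := exists_of_mem_support_mul hg
    rw [← one_smul k (mono q _)] at hg''
    rw [Prod.snd_add, hX g' hg', eq_of_mem_support_smul_mono hg'', add_neg_cancel]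
  have hXF : tensorToTorus hα hq1 hq2 X = F * mono q (0, Pi.single i 1) := by
    have : mono q ((0 : ι → ℤ), -Pi.single i 1) * mono q (0, Pi.single i 1) = 1 := by
      rw [mono_mul_mono]
      simp [one_def]
      rfl
    rw [hF, mul_assoc, this, mul_one]
  have hne : (α i / (q - 1)) • (mono q (Pi.single i 1, 0) - 1) ≠ 0 := by
    refine smul_ne_zero (div_ne_zero (hα i) (sub_ne_zero.2 hq1)) (sub_ne_zero.2 fun h => ?_)
    have := congrArg (fun p => p.coeff 0) h
    simp [one_def] at this
  have hcomm : Commute ((α i / (q - 1)) • (mono q (Pi.single i 1, 0) - 1)) G :=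
    Commute.smul_left ((commute_mono_zero hG _).sub_left (Commute.one_left G)) _
  -- In the torus `X = F xᵢ` and `Y = yᵢ G` with `F`, `G` of weight zero. As `xᵢ yᵢ` is a polynomial
  -- in `hᵢ`, it commutes with `G` and can be cancelled; then `F` and `G`, as factors of a monomial,
  -- are monomials.
  have hFG : F * G = c • mono q (a, 0) := by
    refine mul_right_cancel₀ hne ?_
    rw [hprod] at hXY
    rw [map_mul, map_mul, ← hx, ← hy, hjx] at hprod
    rw [← hXY, map_mul, hXF, hYG, ← hy, mul_assoc F G, ← hcomm.eq, ← hprod]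
    simp only [mul_assoc]
  obtain ⟨⟨b, hb, g, hFg⟩, ⟨b', hb', g', hGg⟩⟩ := eq_smul_mono_of_mul_eq hc hFG
  have hg : g = (g.1, 0) := by
    refine Prod.ext rfl (hF0 g ?_)
    rw [hFg]
    simp [hb]
  have hg' : g' = (g'.1, 0) := by
    refine Prod.ext rfl (hG g' ?_)
    rw [hGg]
    simp [hb']
  obtain ⟨d, hd, e⟩ := exists_tensorToTorus_torusTensor hα hq1 hq2 g.1
  obtain ⟨d', hd', e'⟩ := exists_tensorToTorus_torusTensor hα hq1 hq2 g'.1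
  refine ⟨⟨b / d, div_ne_zero hb hd, g.1, hinj ?_⟩, b' / d', div_ne_zero hb' hd', g'.1, hinj ?_⟩
  · rw [map_smul, map_mul, e, hjx, hXF, hFg, ← hg, ← smul_mul_assoc, smul_smul,
      div_mul_cancel₀ _ hd]
  · rw [map_smul, map_mul, e', hYG, hGg, ← hg', ← mul_smul_comm, smul_smul,
      div_mul_cancel₀ _ hd']

end Factor

/-! ### Rigidity and surjectivity of a homomorphism -/

section Main

variable {β : ι → k} (hα : ∀ i, α i ≠ 0) (hβ : ∀ i, β i ≠ 0) (hq1 : (q : k) ≠ 1)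
  (hq2 : (q : k) + 1 ≠ 0) (hq : ∀ m : ℤ, q ^ m = 1 → m = 0)
  (φ : (⨂[k] i, QWeyl (α i) (q : k)) →ₐ[k] (⨂[k] i, QWeyl (β i) (q : k)))

include hα

lemma exists_map_normalElt : ∃ (M : Matrix ι ι ℤ) (c : ι → k), (∀ i, c i ≠ 0) ∧
    ∀ i, (tensorToTorus hβ hq1 hq2).comp φ
      (PiTensorProduct.singleAlgHom (R := k) i (normalElt (α i) (q : k))) =
        c i • mono q (M i, 0) := by
  have (i : ι) := exists_tensorToTorus_of_isUnit hβ hq1 hq2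
    (((normalUnit (hα i) q.ne_zero).isUnit.map
      (PiTensorProduct.singleAlgHom (R := k) (A := fun i => QWeyl (α i) (q : k)) i)).map φ)
  choose c hc M hM using this
  exact ⟨M, c, hc, hM⟩

variable {φ} {M D : Matrix ι ι ℤ} {c : ι → k} (hc : ∀ i, c i ≠ 0)
  (hφ : ∀ i, (tensorToTorus hβ hq1 hq2).comp φ
    (PiTensorProduct.singleAlgHom (R := k) i (normalElt (α i) (q : k))) = c i • mono q (M i, 0))
  (hMD : M * D = 1)

include hc hφ hMD hq

omit hα in
lemma snd_eq_mulVec_of_mem_support {d : ι → ℤ} {g : (ι → ℤ) × (ι → ℤ)}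
    (hg : g ∈ (tensorToTorus hβ hq1 hq2 (φ (weightTensor q α d))).coeff.support) :
    g.2 = Matrix.mulVec D d := by
  rw [← dotProduct_of_mem_support_map hc hφ hq hg, Matrix.mulVec_mulVec,
    mul_eq_one_comm.1 hMD, Matrix.one_mulVec]

omit hα in
lemma latticeRep_map_weightTensor_eq_zero {d m : ι → ℤ} {i : ι} (h : Matrix.mulVec D d i < 0)
    (hm : m i = 0) : latticeRep (tensorToTorus hβ hq1 hq2 (φ (weightTensor q α d)))
      (Finsupp.single m 1) = 0 :=
  latticeRep_single_eq_zero (tensorToTorus_mem_halfSpaceStabilizer hβ hq1 hq2 _ i)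
    (fun g hg => by
      rwa [snd_eq_mulVec_of_mem_support hβ hq1 hq2 hq hc hφ hMD hg]) hm

omit hα in
-- The image of `yₗ` has negative weight in direction `i`, so it kills the point mass at `m`. Then
-- `xₗ yₗ = (hₗ - αₗ)/(q - 1)` forces the image of `hₗ` to have eigenvalue `αₗ` there.
lemma root_of_pos {i l : ι} (h : 0 < D i l) {m : ι → ℤ} (hm : m i = 0) :
    c l * ((q ^ (M l ⬝ᵥ m) : kˣ) : k) = α l := by
  have h0 := latticeRep_map_weightTensor_eq_zero hβ hq1 hq2 hq hc hφ hMD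
    (d := Pi.single l (-1)) (i := i) (m := m) (by simpa [Matrix.mulVec_single] using h) hm
  rw [weightTensor_single, weightElt_neg_one] at h0
  have h1 := congrArg (fun z => latticeRep ((tensorToTorus hβ hq1 hq2).comp φ
    (PiTensorProduct.singleAlgHom (R := k) (A := fun i => QWeyl (α i) (q : k)) l z))
      (Finsupp.single m 1)) (gen_two_mul_gen_one (α := α l) hq1)
  simp only [map_mul, Module.End.mul_apply, map_smul, map_sub, map_one, hφ, LinearMap.smul_apply,
    LinearMap.sub_apply, latticeRep_mono_zero_single, Module.End.one_apply] at h1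
  rw [AlgHom.comp_apply, AlgHom.comp_apply, h0, map_zero] at h1
  have h2 := (smul_eq_zero.1 h1.symm).resolve_left (inv_ne_zero (sub_ne_zero.2 hq1))
  have h3 := DFunLike.congr_fun h2 m
  simpa [sub_eq_zero] using h3

omit hα in
-- Now the image of `xₗ` kills the wall. The product to use is `yₗ xₗ = (q hₗ - αₗ)/(q - 1)`, whence
-- the extra factor `q`.
lemma root_of_neg {i l : ι} (h : D i l < 0) {m : ι → ℤ} (hm : m i = 0) :
    q * c l * ((q ^ (M l ⬝ᵥ m) : kˣ) : k) = α l := by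
  have h0 := latticeRep_map_weightTensor_eq_zero hβ hq1 hq2 hq hc hφ hMD
    (d := Pi.single l 1) (i := i) (m := m) (by simpa [Matrix.mulVec_single] using h) hm
  rw [weightTensor_single, weightElt_one] at h0
  have h1 := congrArg (fun z => latticeRep ((tensorToTorus hβ hq1 hq2).comp φ
    (PiTensorProduct.singleAlgHom (R := k) (A := fun i => QWeyl (α i) (q : k)) l z))
      (Finsupp.single m 1)) (gen_one_mul_gen_two (α := α l) hq1)
  simp only [map_mul, Module.End.mul_apply, map_smul, map_sub, map_one, hφ, LinearMap.smul_apply,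
    LinearMap.sub_apply, latticeRep_mono_zero_single, Module.End.one_apply] at h1
  rw [AlgHom.comp_apply, AlgHom.comp_apply, h0, map_zero] at h1
  have h2 := (smul_eq_zero.1 h1.symm).resolve_left (inv_ne_zero (sub_ne_zero.2 hq1))
  have h3 := DFunLike.congr_fun h2 m
  simpa [sub_eq_zero, mul_assoc] using h3

omit hα in
-- The eigenvalue of the image of `hₗ` is constant along the wall. Comparing the origin with the
-- unit vector in direction `i'` gives `q ^ M l i' = 1`.
lemma eq_zero_of_ne {i l : ι} (h : D i l ≠ 0) {i' : ι} (hi' : i' ≠ i) : M l i' = 0 := by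
  have hm : (Pi.single i' 1 : ι → ℤ) i = 0 := Pi.single_eq_of_ne hi'.symm 1
  have key : c l * ((q ^ (M l ⬝ᵥ Pi.single i' 1) : kˣ) : k) = c l * 1 := by
    obtain h | h := lt_or_gt_of_ne h
    · have h1 := root_of_neg hβ hq1 hq2 hq hc hφ hMD h hm
      have h2 := root_of_neg hβ hq1 hq2 hq hc hφ hMD h (m := 0) rfl
      rw [← h2, dotProduct_zero, zpow_zero, Units.val_one, mul_assoc, mul_assoc] at h1
      exact mul_left_cancel₀ q.ne_zero h1
    · have h1 := root_of_pos hβ hq1 hq2 hq hc hφ hMD h hm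
      have h2 := root_of_pos hβ hq1 hq2 hq hc hφ hMD h (m := 0) rfl
      rw [← h2, dotProduct_zero, zpow_zero, Units.val_one] at h1
      exact h1
  have := hq _ (Units.ext (mul_left_cancel₀ (hc l) key))
  simpa using this

omit hα in
-- Row `l` of `M` is concentrated at `i`, so `(M D) l l = 1` reads `M l i * D i l = 1` in `ℤ`. A
-- second nonzero entry in column `l` of `D` would force `M l i = 0`.
lemma eq_single_of_ne_zero {i l : ι} (h : D i l ≠ 0) :
    (D i l = 1 ∨ D i l = -1) ∧ M l = Pi.single i (D i l) ∧
      ∀ z : ℤ, Matrix.mulVec D (Pi.single l z) = Pi.single i (D i l * z) := by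
  have hM : ∀ i', i' ≠ i → M l i' = 0 := fun i' hi' =>
    eq_zero_of_ne hβ hq1 hq2 hq hc hφ hMD h hi'
  have h1 : M l i * D i l = 1 := by
    have := congrFun (congrFun hMD l) l
    rwa [Matrix.mul_apply, Finset.sum_eq_single i (fun i' _ hi' => by rw [hM i' hi', zero_mul])
      (by simp), Matrix.one_apply_eq] at this
  have hD : ∀ i', i' ≠ i → D i' l = 0 := by
    intro i' hi'
    by_contra hne
    rw [eq_zero_of_ne hβ hq1 hq2 hq hc hφ hMD hne hi'.symm, zero_mul] at h1
    exact zero_ne_one h1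
  have h2 := Int.eq_one_or_neg_one_of_mul_eq_one' h1
  refine ⟨h2.imp And.right And.right, ?_, fun z => ?_⟩
  · ext i'
    obtain rfl | hi' := eq_or_ne i' i
    · rw [Pi.single_eq_same]
      omega
    · rw [hM i' hi', Pi.single_eq_of_ne hi']
  · ext i'
    obtain rfl | hi' := eq_or_ne i' i
    · simp [Matrix.mulVec_single]
    · simp [Matrix.mulVec_single, hD i' hi', hi']

/-- Up to a scalar, `h ^ a` is the image of `h ^ (a D)`, because `D M = 1`. -/
lemma torusTensor_mem_range (a : ι → ℤ) : torusTensor hβ a ∈ φ.range := by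
  obtain ⟨b, hb, h⟩ := exists_map_torusTensor hα hc hφ (Matrix.vecMul a D)
  rw [Matrix.vecMul_vecMul, mul_eq_one_comm.1 hMD, Matrix.vecMul_one] at h
  obtain ⟨b', hb', h'⟩ := exists_tensorToTorus_torusTensor hβ hq1 hq2 a
  have : torusTensor hβ a = φ ((b' / b) • torusTensor hα (Matrix.vecMul a D)) := by
    apply tensorToTorus_injective hβ hq1 hq2 hq
    rw [map_smul, map_smul, ← AlgHom.comp_apply, h, h', smul_smul, div_mul_cancel₀ _ hb]
  exact this ▸ ⟨_, rfl⟩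

omit hα hc hφ hq hMD [Fintype ι] [DecidableEq ι] in
lemma mem_range_of_eq_smul_mul {X t : ⨂[k] i, QWeyl (β i) (q : k)} {b : k} {a : ι → ℤ} (hb : b ≠ 0)
    (hmem : ∀ a, torusTensor hβ a ∈ φ.range) (hX : X ∈ φ.range)
    (h : X = b • (torusTensor hβ a * t) ∨ X = b • (t * torusTensor hβ a)) : t ∈ φ.range := by
  obtain h | h := h
  · have : t = b⁻¹ • (torusTensor hβ (-a) * X) := by
      rw [h, mul_smul_comm, smul_smul, inv_mul_cancel₀ hb, one_smul, ← mul_assoc,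
        ← torusTensor_add, neg_add_cancel, torusTensor_zero, one_mul]
    rw [this]
    exact Subalgebra.smul_mem _ (Subalgebra.mul_mem _ (hmem _) hX) _
  · have : t = b⁻¹ • (X * torusTensor hβ (-a)) := by
      rw [h, smul_mul_assoc, smul_smul, inv_mul_cancel₀ hb, one_smul, mul_assoc,
        ← torusTensor_add, add_neg_cancel, torusTensor_zero, mul_one]
    rw [this]
    exact Subalgebra.smul_mem _ (Subalgebra.mul_mem _ hX (hmem _)) _

lemma gen_mem_range (i : ι) :
    PiTensorProduct.singleAlgHom (R := k) i (gen (β i) (q : k) 2) ∈ φ.range ∧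
      PiTensorProduct.singleAlgHom (R := k) i (gen (β i) (q : k) 1) ∈ φ.range := by
  have hmem := torusTensor_mem_range hα hβ hq1 hq2 hq hc hφ hMD
  have hq3 := sub_ne_zero.2 hq1
  obtain ⟨l, hl⟩ : ∃ l, D i l ≠ 0 := by
    by_contra! h0
    have hDM : D * M = 1 := mul_eq_one_comm.1 hMD
    have := congrFun (congrFun hDM i) i
    rw [Matrix.mul_apply, Matrix.one_apply_eq] at this
    simp [h0] at this
  suffices h : ∃ X ∈ φ.range, ∃ Y ∈ φ.range,
      (∀ g ∈ (tensorToTorus hβ hq1 hq2 X).coeff.support, g.2 = Pi.single i 1) ∧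
      (∀ g ∈ (tensorToTorus hβ hq1 hq2 Y).coeff.support, g.2 = -Pi.single i 1) ∧
      ∃ b : k, b ≠ 0 ∧ ∃ a, tensorToTorus hβ hq1 hq2 (X * Y) =
        (b • mono q (a, 0)) * ((β i / (q - 1)) • (mono q (Pi.single i 1, 0) - 1)) by
    obtain ⟨X, hXr, Y, hYr, hX, hY, b, hb, a, hXY⟩ := h
    rw [← tensorToTorus_single_mul hβ hq1 hq2] at hXY
    obtain ⟨⟨b₁, hb₁, a₁, h₁⟩, b₂, hb₂, a₂, h₂⟩ :=
      exists_eq_torusTensor_mul hβ hq1 hq2 hq hX hY hb hXY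
    exact ⟨mem_range_of_eq_smul_mul hβ hb₁ hmem hXr (Or.inl h₁),
      mem_range_of_eq_smul_mul hβ hb₂ hmem hYr (Or.inr h₂)⟩
  obtain ⟨hsign, hM, hD⟩ := eq_single_of_ne_zero hβ hq1 hq2 hq hc hφ hMD hl
  have hsupp : ∀ z : ℤ, ∀ g ∈ (tensorToTorus hβ hq1 hq2 (φ (weightTensor q α
      (Pi.single l z)))).coeff.support, g.2 = Pi.single i (D i l * z) := fun z g hg => by
    rw [snd_eq_mulVec_of_mem_support hβ hq1 hq2 hq hc hφ hMD hg, hD]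
  have hjm := hφ l
  rw [hM, AlgHom.comp_apply] at hjm
  have hx := weightTensor_single (q := q) (α := α) l 1
  have hy := weightTensor_single (q := q) (α := α) l (-1)
  rw [weightElt_one] at hx
  rw [weightElt_neg_one] at hy
  obtain h | h := hsign
  -- Here `hₗ` goes to `αₗ h^(eᵢ)` in the torus, so `xₗ yₗ` and `xᵢ yᵢ` both become multiples of
  -- `h^(eᵢ) - 1`, with ratio `αₗ/βᵢ`.
  · refine ⟨_, ⟨weightTensor q α (Pi.single l 1), rfl⟩, _, ⟨weightTensor q α (Pi.single l (-1)), rfl⟩,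
      fun g hg => ?_, fun g hg => ?_, α l / β i, div_ne_zero (hα l) (hβ i), 0, ?_⟩
    · rw [hsupp 1 g hg, h, one_mul]
    · rw [hsupp (-1) g hg, h, one_mul, Pi.single_neg]
    · have hroot := root_of_pos hβ hq1 hq2 hq hc hφ hMD (i := i) (l := l) (by omega)
        (m := 0) rfl
      rw [dotProduct_zero, zpow_zero, Units.val_one, mul_one] at hroot
      have h1 : mono q ((0 : ι → ℤ), (0 : ι → ℤ)) = 1 := rfl
      rw [hx, hy]
      change tensorToTorus hβ hq1 hq2 (φ _ * φ _) = _
      rw [← map_mul φ, ← map_mul, gen_two_mul_gen_one hq1]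
      simp only [map_smul, map_sub, map_one]
      rw [hjm, hroot, h, h1, smul_mul_smul_comm, one_mul]
      have := hβ i
      match_scalars <;> field_simp
  -- With the opposite sign `x` and `y` exchange roles, and `q hₗ` goes to `αₗ h^(-eᵢ)`. The unit
  -- comes from `h^(-eᵢ) - 1 = -h^(-eᵢ) (h^(eᵢ) - 1)`.
  · refine ⟨_, ⟨weightTensor q α (Pi.single l (-1)), rfl⟩, _, ⟨weightTensor q α (Pi.single l 1), rfl⟩,
      fun g hg => ?_, fun g hg => ?_, -(α l / β i), neg_ne_zero.2 (div_ne_zero (hα l) (hβ i)),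
      -Pi.single i 1, ?_⟩
    · rw [hsupp (-1) g hg, h, neg_one_mul, neg_neg]
    · rw [hsupp 1 g hg, h, mul_one, Pi.single_neg]
    · have hroot := root_of_neg hβ hq1 hq2 hq hc hφ hMD (i := i) (l := l) (by omega)
        (m := 0) rfl
      rw [dotProduct_zero, zpow_zero, Units.val_one, mul_one] at hroot
      have h1 : mono q ((0 : ι → ℤ), (0 : ι → ℤ)) = 1 := rfl
      rw [hx, hy]
      change tensorToTorus hβ hq1 hq2 (φ _ * φ _) = _
      rw [← map_mul φ, ← map_mul, gen_one_mul_gen_two hq1]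
      simp only [map_smul, map_sub, map_one]
      rw [hjm, smul_smul (q : k), hroot, h, smul_mul_smul_comm, mul_sub, mono_mul_mono_zero,
        Prod.mk_add_mk, neg_add_cancel, add_zero, h1, mul_one, Pi.single_neg]
      have := hβ i
      match_scalars <;> field_simp

end Main

/-- Every algebra homomorphism between tensor products of the algebras `𝒜_{α,q}` is bijective. -/
theorem bijective_of_algHom {β : ι → k} (hα : ∀ i, α i ≠ 0) (hβ : ∀ i, β i ≠ 0)
    (hq : ∀ m : ℤ, q ^ m = 1 → m = 0)
    (φ : (⨂[k] i, QWeyl (α i) (q : k)) →ₐ[k] (⨂[k] i, QWeyl (β i) (q : k))) :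
    Function.Bijective φ := by
  have hq1 : (q : k) ≠ 1 := fun h => by
    have := hq 1 (by rw [zpow_one]; exact Units.ext h)
    omega
  have hq2 : (q : k) + 1 ≠ 0 := fun h => by
    have h1 : (q : k) = -1 := eq_neg_of_add_eq_zero_left h
    have := hq 2 (Units.ext (by
      rw [show (2 : ℤ) = ((2 : ℕ) : ℤ) from rfl, zpow_natCast, Units.val_pow_eq_pow_val, h1]
      simp))
    omega
  obtain ⟨M, c, hc, hφ⟩ := exists_map_normalElt hα hβ hq1 hq2 φ
  obtain ⟨D, hMD⟩ := exists_mul_eq_one hc hφ hq hq1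
  constructor
  · have := injective_of_map_normalElt hc hφ hα hq hq1 hq2
    exact Function.Injective.of_comp (f := tensorToTorus hβ hq1 hq2) this
  · rw [← AlgHom.range_eq_top]
    refine PiTensorProduct.eq_top_of_single_mem fun i z => ?_
    refine range_le_of_gen_mem (PiTensorProduct.singleAlgHom (R := k)
      (A := fun i => QWeyl (β i) (q : k)) i) (fun j => ?_) ⟨z, rfl⟩
    have h := gen_mem_range hα hβ hq1 hq2 hq hc hφ hMD i
    have hi : PiTensorProduct.singleAlgHom (R := k) (A := fun i => QWeyl (β i) (q : k)) i
        (normalInv (β i) (q : k)) ∈ φ.range := by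
      -- Cancelling `hᵢ` from `1 = hᵢ hᵢ⁻¹` puts `hᵢ⁻¹` in the range; it is needed to recover `e₁`.
      refine mem_range_of_eq_smul_mul hβ (X := 1) (b := 1) (a := Pi.single i 1) one_ne_zero
        (torusTensor_mem_range hα hβ hq1 hq2 hq hc hφ hMD) (one_mem _) (Or.inl ?_)
      rw [torusTensor_single_one, ← map_mul, normalElt_mul_normalInv (hβ i) q.ne_zero, map_one,
        one_smul]
    fin_cases j
    · change PiTensorProduct.singleAlgHom i (gen (β i) (q : k) 0) ∈ φ.range
      rw [gen_zero_eq (hβ i) q.ne_zero hq2, map_smul, map_mul, map_mul]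
      exact Subalgebra.smul_mem _ (Subalgebra.mul_mem _ hi (Subalgebra.mul_mem _ h.1 h.1)) _
    · exact h.2
    · exact h.1

end QWeyl

/-- Let `k` be a field and `q ∈ k^*` not a root of unity, and let `α i`, `α' i` be nonzero.
Every homomorphism of `k`-algebras from `𝒜_{α 1,q} ⊗ … ⊗ 𝒜_{α n,q}` to
`𝒜_{α' 1,q} ⊗ … ⊗ 𝒜_{α' n,q}` (tensor products over `k`) is an isomorphism. -/
theorem theorem1p3 {k : Type*} [Field k] (q : k) (hq0 : q ≠ 0)
    (hq : ∀ m : ℕ, 0 < m → q ^ m ≠ 1)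
    (n : ℕ) (hn : 1 ≤ n) (α α' : Fin n → k)
    (hα : ∀ i, α i ≠ 0) (hα' : ∀ i, α' i ≠ 0)
    (φ : (⨂[k] i, QWeyl (α i) q) →ₐ[k] (⨂[k] i, QWeyl (α' i) q)) :
    ∃ e : (⨂[k] i, QWeyl (α i) q) ≃ₐ[k] (⨂[k] i, QWeyl (α' i) q),
      (e : (⨂[k] i, QWeyl (α i) q) →ₐ[k] (⨂[k] i, QWeyl (α' i) q)) = φ := by
  obtain ⟨q, rfl⟩ : ∃ u : kˣ, (u : k) = q := ⟨Units.mk0 q hq0, rfl⟩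
  have hq' : ∀ m : ℤ, q ^ m = 1 → m = 0 := by
    intro m hm
    by_contra hne
    refine hq m.natAbs (Int.natAbs_pos.2 hne) ?_
    obtain h | h := m.natAbs_eq
    · rw [h, zpow_natCast] at hm
      rw [← Units.val_pow_eq_pow_val, hm, Units.val_one]
    · rw [h, zpow_neg, zpow_natCast, inv_eq_one] at hm
      rw [← Units.val_pow_eq_pow_val, hm, Units.val_one]
  exact ⟨AlgEquiv.ofBijective φ (QWeyl.bijective_of_algHom hα hα' hq' φ), AlgHom.ext fun _ => rfl⟩
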